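/- **Setting.** An instance of a constrained metric $k$-median problem consists of a finite nonempty set $L$ of facility locations and a finite set $C$ of clients in a metric space $(X,d)$ (the two sets may overlap), an integer $1\le k\le |L|$, and a nonempty set $\mathbb{C}$ of feasible clusterings, i.e. of partitions $\mathcal{C}=(C_1,\dots,C_k)$ of $C$ into $k$ (possibly empty) labelled clusters. The input of an algorithm consists of $k$, the pairwise distances between the points of $C$ and $L$, and a description of the constraints; $n$ denotes its size: $|C|+|L|$ plus the size of the description of the constraints. A $k$-center-set is a set $F=\{f_1,\dots,f_k\}$ of $k$ distinct elements of $L$. Put $$\Psi(F,\mathcal{C})=\min_{\pi\in S_k}\ \sum_{i=1}^k\sum_{x\in C_i} d(x,f_{\pi(i)}),\qquad \Psi^*(\mathcal{C})=\min_{F}\Psi(F,\mathcal{C}),$$ where $F$ ranges over all $k$-center-sets. A constrained metric $k$-median problem is a collection of such instances; the task is to find $\mathcal{C}\in\mathbb{C}$ minimizing $\Psi^*(\mathcal{C})$. An efficient partition algorithm for the problem is a deterministic algorithm that, given an instance and a $k$-center-set $F$, computes in time $n^{O(1)}$ a clustering $\mathcal{C}\in\mathbb{C}$ that minimizes $\Psi(F,\cdot)$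 over $\mathbb{C}$. Algorithms are programs of a machine with linked-list memory, exact real arithmetic $(+,-,\times,/,\le)$ at unit cost, and (for randomized algorithms) unit-cost fair coin flips. **Corollary ($k$-median).** For every constrained metric $k$-median problem that has an efficient partition algorithm there are a randomized algorithm and a constant $c$ such that, for every instance of the problem and every $0<\varepsilon\le 1$, the algorithm, given the instance and $\varepsilon$, 1. always halts after at most $c\,(k/\varepsilon)^{ck}\,n^{c}$ steps, and outputs a $k$-center-set $F$ and a clustering $\mathcal{C}\in\mathbb{C}$; 2. with probability at least $1/2$ outputs a $(3+\varepsilon)$-approximation, that is, $\Psi(F,\mathcal{C})\le(3+\varepsilon)\,\Psi^*(\mathcal{C}')$ for all $\mathcal{C}'\in\mathbb{C}$ (in particular $\Psi^*(\mathcal{C})\le(3+\varepsilon)\min_{\mathcal{C}'\in\mathbb{C}}\Psi^*(\mathcal{C}')$); 3. if $C\subseteq L$, with probability at least $1/2$ outputs a $(2+\varepsilon)$-approximation, that is, $\Psi(F,\mathcal{C})\le(2+\varepsilon)\,\Psi^*(\mathcal{C}')$ for all $\mathcal{C}'\in\mathbb{C}$. -/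

import Mathlib

universe u

namespace KMedian

/-! ## The machine model

A first-order list-processing machine with exact real arithmetic (a real RAM with linked memory):
data are binary trees whose leaves are `nil` or real numbers. All elementary operations have unit
cost, the only program constant is the number one (there is no rounding operation), and the only
source of randomness is an instruction that flips a fair coin. -/

/-- Data: `nil`, a real number, or a pair. Lists are built from `nil` and `pair` in the usual way. -/
inductive Val : Type
  | nil : Val
  | real (x : ℝ) : Val
  | pair (a b : Val) : Val

namespace Val

/-- Truth values: `nil` is false; the constant `pair nil nil` (like any non-`nil` value) is true. -/
def ofBool : Bool → Val
  | false => nil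
  | true => pair nil nil

/-- A list of values as a linked list. -/
def ofList : List Val → Val
  | [] => nil
  | a :: l => pair a (ofList l)

/-- Number of nodes of a value. -/
def size : Val → ℕ
  | nil => 1
  | real _ => 1
  | pair a b => a.size + b.size + 1

/-- A finite sequence of values as a linked list. -/
def ofSeq {m : ℕ} (f : Fin m → Val) : Val := ofList (List.ofFn f)

/-- A real matrix as a linked list of rows. -/
def ofMatrix {m l : ℕ} (M : Fin m → Fin l → ℝ) : Val :=
  ofSeq fun i => ofSeq fun j => real (M i j)

end Val

/-- Elementary deterministic operations. -/
inductive Prim : Type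
  | id | nil | one | fst | snd | isReal | add | sub | mul | div | le

/-- The effect of an elementary operation (the result is `nil` on arguments of the wrong shape,
and division by zero gives zero). -/
noncomputable def Prim.apply : Prim → Val → Val
  | .id, v => v
  | .nil, _ => .nil
  | .one, _ => .real 1
  | .fst, .pair a _ => a
  | .snd, .pair _ b => b
  | .isReal, .real _ => Val.ofBool true
  | .add, .pair (.real x) (.real y) => .real (x + y)
  | .sub, .pair (.real x) (.real y) => .real (x - y)
  | .mul, .pair (.real x) (.real y) => .real (x * y)
  | .div, .pair (.real x) (.real y) => .real (x / y)
  | .le, .pair (.real x) (.real y) => by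
      classical exact Val.ofBool (decide (x ≤ y))
  | _, _ => .nil

/-- Programs; a program acts on one value. -/
inductive Code : Type
  /-- an elementary operation -/
  | prim (p : Prim) : Code
  /-- flip a fair coin and return the outcome -/
  | flip : Code
  /-- run `f` and `g` on the input and pair the results -/
  | pair (f g : Code) : Code
  /-- run `f`, then run `g` on its result -/
  | comp (g f : Code) : Code
  /-- run `f` or `g` on the input, according as the test `c` succeeds or fails on it -/
  | cond (c f g : Code) : Code
  /-- while the test `c` succeeds on the current value, replace that value by its image under `f` -/
  | loop (c f : Code) : Code

/-- `Eval c v bs w t`: started on `v`, when the coin flips come out as the entries of `bs` in this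
order (and exactly `bs.length` coins are flipped), the program `c` halts with result `w` after
`t` steps. -/
inductive Eval : Code → Val → List Bool → Val → ℕ → Prop
  | prim (p : Prim) (v : Val) : Eval (.prim p) v [] (p.apply v) 1
  | flip (v : Val) (b : Bool) : Eval .flip v [b] (Val.ofBool b) 1
  | pair {f g : Code} {v a b : Val} {bs bs' : List Bool} {s t : ℕ} :
      Eval f v bs a s → Eval g v bs' b t →
      Eval (.pair f g) v (bs ++ bs') (.pair a b) (s + t + 1)
  | comp {f g : Code} {v w z : Val} {bs bs' : List Bool} {s t : ℕ} :
      Eval f v bs w s → Eval g w bs' z t →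
      Eval (.comp g f) v (bs ++ bs') z (s + t + 1)
  | cond_true {c f g : Code} {v b w : Val} {bs bs' : List Bool} {s t : ℕ} :
      Eval c v bs b s → b ≠ .nil → Eval f v bs' w t →
      Eval (.cond c f g) v (bs ++ bs') w (s + t + 1)
  | cond_false {c f g : Code} {v w : Val} {bs bs' : List Bool} {s t : ℕ} :
      Eval c v bs .nil s → Eval g v bs' w t →
      Eval (.cond c f g) v (bs ++ bs') w (s + t + 1)
  | loop_stop {c f : Code} {v : Val} {bs : List Bool} {s : ℕ} :
      Eval c v bs .nil s → Eval (.loop c f) v bs v (s + 1)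
  | loop_step {c f : Code} {v b w z : Val} {bs bs' bs'' : List Bool} {s t r : ℕ} :
      Eval c v bs b s → b ≠ .nil → Eval f v bs' w t → Eval (.loop c f) w bs'' z r →
      Eval (.loop c f) v (bs ++ (bs' ++ bs'')) z (s + t + r + 1)

/-- The coin flips determine the run: two runs on the same input whose coin sequences have a common
extension are equal. -/
theorem Eval.deterministic {c : Code} {v w w' : Val} {bs bs' r r' : List Bool} {t t' : ℕ}
    (h : Eval c v bs w t) (h' : Eval c v bs' w' t') (hr : bs ++ r = bs' ++ r') :
    bs = bs' ∧ w = w' ∧ t = t' := by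
  induction h generalizing bs' w' t' r r' with
  | prim p v => cases h'; simp
  | flip v b => cases h'; simp_all
  | pair _ _ ih1 ih2 =>
    cases h' with
    | pair k1 k2 =>
      simp only [List.append_assoc] at hr
      obtain ⟨rfl, rfl, rfl⟩ := ih1 k1 hr
      obtain ⟨rfl, rfl, rfl⟩ := ih2 k2 (List.append_cancel_left hr)
      simp
  | comp _ _ ih1 ih2 =>
    cases h' with
    | comp k1 k2 =>
      simp only [List.append_assoc] at hr
      obtain ⟨rfl, rfl, rfl⟩ := ih1 k1 hr
      obtain ⟨rfl, rfl, rfl⟩ := ih2 k2 (List.append_cancel_left hr)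
      simp
  | cond_true _ hb _ ih1 ih2 =>
    cases h' with
    | cond_true k1 _ k2 =>
      simp only [List.append_assoc] at hr
      obtain ⟨rfl, rfl, rfl⟩ := ih1 k1 hr
      obtain ⟨rfl, rfl, rfl⟩ := ih2 k2 (List.append_cancel_left hr)
      simp
    | cond_false k1 k2 =>
      simp only [List.append_assoc] at hr
      exact absurd (ih1 k1 hr).2.1 hb
  | cond_false _ _ ih1 ih2 =>
    cases h' with
    | cond_true k1 hb k2 =>
      simp only [List.append_assoc] at hr
      exact absurd (ih1 k1 hr).2.1.symm hb
    | cond_false k1 k2 =>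
      simp only [List.append_assoc] at hr
      obtain ⟨rfl, -, rfl⟩ := ih1 k1 hr
      obtain ⟨rfl, rfl, rfl⟩ := ih2 k2 (List.append_cancel_left hr)
      simp
  | loop_stop _ ih =>
    cases h' with
    | loop_stop k => obtain ⟨rfl, -, rfl⟩ := ih k hr; simp
    | loop_step k1 hb k2 k3 =>
      simp only [List.append_assoc] at hr
      exact absurd (ih k1 hr).2.1.symm hb
  | loop_step _ hb _ _ ih1 ih2 ih3 =>
    cases h' with
    | loop_stop k =>
      simp only [List.append_assoc] at hr
      exact absurd (ih1 k hr).2.1 hb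
    | loop_step k1 _ k2 k3 =>
      simp only [List.append_assoc] at hr
      obtain ⟨rfl, rfl, rfl⟩ := ih1 k1 hr
      replace hr := List.append_cancel_left hr
      obtain ⟨rfl, rfl, rfl⟩ := ih2 k2 hr
      replace hr := List.append_cancel_left hr
      obtain ⟨rfl, rfl, rfl⟩ := ih3 k3 hr
      simp

/-- With the infinite sequence `ω` of coin flips, the program `c` started on `v` halts with
result `w` after `t` steps. -/
def Code.HaltsWith (c : Code) (v : Val) (ω : ℕ → Bool) (w : Val) (t : ℕ) : Prop :=
  ∃ m : ℕ, Eval c v (List.ofFn fun i : Fin m => ω i) w t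

/-- The law of an infinite sequence of independent fair coin flips. -/
noncomputable def coinMeasure : MeasureTheory.Measure (ℕ → Bool) :=
  MeasureTheory.Measure.infinitePi fun _ => (PMF.uniformOfFintype Bool).toMeasure

/-! ## Constrained metric `k`-median problems -/

/-- An instance `(C, L, k, d, ℂ)` of a constrained metric `k`-median problem. The finite sets `C` of
clients and `L` of facility locations of the metric space `X` are listed without repetition (they
may overlap). A clustering of `C` into `C₁, …, C_k` is given by the function that maps each client
to the index of its cluster (clusters may be empty). `data` is the part of the input that describes
the constraints (such as cluster sizes or colours of clients). -/
structure Instance : Type (u + 1) where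
  X : Type u
  [metric : MetricSpace X]
  numClients : ℕ
  numFacilities : ℕ
  client : Fin numClients ↪ X
  facility : Fin numFacilities ↪ X
  k : ℕ
  k_pos : 0 < k
  k_le : k ≤ numFacilities
  data : Val
  feasible : Set (Fin numClients → Fin k)
  feasible_nonempty : feasible.Nonempty

attribute [instance] Instance.metric

namespace Instance

variable (I : Instance.{u})

/-- A clustering of the clients into `k` labelled clusters. -/
abbrev Clustering : Type := Fin I.numClients → Fin I.k

/-- A `k`-center-set: `k` distinct facility locations. -/
abbrev CenterSet : Type := Fin I.k ↪ Fin I.numFacilities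

/-- `Ψ(F, 𝒞)`, the minimum over all permutations `π` of `∑ᵢ ∑_{x ∈ Cᵢ} d(x, f_{π(i)})`. -/
noncomputable def cost (F : I.CenterSet) (σ : I.Clustering) : ℝ :=
  ⨅ π : Equiv.Perm (Fin I.k),
    ∑ i : Fin I.k, ∑ x : Fin I.numClients with σ x = i,
      dist (I.client x) (I.facility (F (π i)))

/-- `Ψ*(𝒞)`, the minimum of `Ψ(F, 𝒞)` over all `k`-center-sets `F`. -/
noncomputable def optCost (σ : I.Clustering) : ℝ :=
  ⨅ F : I.CenterSet, I.cost F σ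

/-- The size of the input. -/
def size : ℕ := I.numClients + I.numFacilities + I.data.size

/-- The input: the number `k`, the distances between all clients and facility locations, and the
description of the constraints. -/
noncomputable def encode : Val :=
  Val.ofList
    [.real (I.k : ℝ),
     Val.ofMatrix fun i j => dist (I.client i) (I.client j),
     Val.ofMatrix fun i j => dist (I.client i) (I.facility j),
     Val.ofMatrix fun i j => dist (I.facility i) (I.facility j),
     I.data]

/-- A center set as the list of the indices of its facilities (counted from zero). -/
noncomputable def encodeCenters (F : I.CenterSet) : Val :=
  Val.ofSeq fun i => .real ((F i : ℕ) : ℝ)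

/-- A clustering as the list of the cluster indices of the clients (counted from zero). -/
noncomputable def encodeClustering (σ : I.Clustering) : Val :=
  Val.ofSeq fun x => .real ((σ x : ℕ) : ℝ)

/-- `C ⊆ L`: every client location is a facility location. -/
def ClientsSubsetFacilities : Prop := Set.range I.client ⊆ Set.range I.facility

/-- The center set `F` and the clustering `σ` form an `α`-approximate solution: `σ` is feasible, and
its cost with the centers `F` is at most `α` times the optimal value. -/
def IsApproxSolution (α : ℝ) (F : I.CenterSet) (σ : I.Clustering) : Prop :=
  σ ∈ I.feasible ∧ ∀ τ ∈ I.feasible, I.cost F σ ≤ α * I.optCost τ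

end Instance

/-- A constrained metric `k`-median problem is a collection of instances. It has an efficient
partition algorithm if a single deterministic program computes, in time polynomial in the size of
the instance, from every instance and every `k`-center-set `F` a feasible clustering that minimizes
`Ψ(F, ·)` among all feasible clusterings. -/
def HasEfficientPartitionAlgorithm (P : Set Instance.{u}) : Prop :=
  ∃ (A : Code) (c : ℕ), ∀ I ∈ P, ∀ F : I.CenterSet, ∃ σ ∈ I.feasible,
    (∀ τ ∈ I.feasible, I.cost F σ ≤ I.cost F τ) ∧
    ∃ t : ℕ, Eval A (.pair (I.encodeCenters F) I.encode) [] (I.encodeClustering σ) t ∧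
      t ≤ c * I.size ^ c

/-- With the coin flips `ω`, the program `B` on the input `(ε, I)` outputs the center set `F` and the
clustering `σ` after `t` steps. -/
def Outputs (B : Code) (I : Instance.{u}) (ε : ℝ) (ω : ℕ → Bool)
    (F : I.CenterSet) (σ : I.Clustering) (t : ℕ) : Prop :=
  B.HaltsWith (.pair (.real ε) I.encode) ω
    (.pair (I.encodeCenters F) (I.encodeClustering σ)) t

/-- The probability that the randomized program `B` on the input `(ε, I)` outputs an
`α`-approximate solution. -/
noncomputable def successProb (B : Code) (I : Instance.{u}) (ε α : ℝ) : ENNReal :=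
  coinMeasure {ω | ∃ F σ t, Outputs B I ε ω F σ t ∧ I.IsApproxSolution α F σ}

end KMedian

/-! The algorithm is deterministic: a greedy cover takes the place of random sampling, so both
success probabilities are one. Let `Ψ` be the optimal cost of a clustering, `g` a guess with `g ≤ Ψ
≤ 2g`, `η = ε/32` and `θ = η² g / k`. A facility location `f` and a client `y` span a ball of
clients around `f`. The greedy algorithm looks for a short list `T` of points such that every ball
either has all its clients in `T` or has `2k` points of `T` in a slightly enlarged copy; a ball for
which this fails is active.

The analysis compares `T` with an unknown optimal solution. Give mass one to each of the `2k` points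
nearest to each optimal center, and give each client additional mass proportional to its connection
cost. If an active ball has a cheap client outside `T`, then that client or a point nearest to its
center is an unhit atom of the enlarged ball; if all its clients outside `T` are expensive, their
additional mass is at least one. Hence a measure of total mass `O(k²/η³)` covers the unhit part of
every active ball (`exists_fractionalHitting`), the best point removes a fraction `η³/(8k³)` of the
total deficit (`pot_greedy_succ_le`), and `O(k³ η⁻³ log n)` rounds leave no active ball.

By Markov's inequality `T` then has points within about the average radius `ρ` of the center of each
nonempty cluster (`exists_cluster_radius`). The `k` locations nearest to such a point contain the
center itself or are `k` replacements within `2ρ` of it; if clients are locations, replacements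
within `ρ` exist. Hall's theorem makes the replacements distinct (`exists_good_centers`). Summed
over the clients, the detour is about `2Ψ` or `Ψ`, whence the factors `3 + ε` and `2 + ε`.

All ordered `k`-tuples of candidates are tried for polynomially many guesses. The power `(log n)^k`
in their number is at most a constant times `k^k n` (`card_bound`). The relation `Computes`
certifies that all this is done by one program. -/

namespace KMedian

/-! ## Polynomially bounded families and a calculus of programs -/

section Calculus

variable {ι κ : Type*} {m : ι → ℕ}

/-- The family `n` is bounded by a polynomial in the measure `m`. -/
def PolyBd (m n : ι → ℕ) : Prop := ∃ d : ℕ, ∀ i, n i ≤ (m i + 2) ^ d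

theorem PolyBd.mono {n n' : ι → ℕ} (h : PolyBd m n') (hn : ∀ i, n i ≤ n' i) : PolyBd m n := by
  obtain ⟨d, hd⟩ := h
  exact ⟨d, fun i => (hn i).trans (hd i)⟩

/-- The shift by two in `PolyBd` makes the base at least two, so that one exponent absorbs all
constants. -/
theorem PolyBd.const (c : ℕ) : PolyBd m fun _ => c :=
  ⟨c, fun i => (Nat.lt_two_pow_self (n := c)).le.trans (Nat.pow_le_pow_left (by omega) c)⟩

theorem PolyBd.self : PolyBd m m := ⟨1, fun i => by simp⟩

theorem PolyBd.mul {n n' : ι → ℕ} (h : PolyBd m n) (h' : PolyBd m n') :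
    PolyBd m fun i => n i * n' i := by
  obtain ⟨d, hd⟩ := h
  obtain ⟨d', hd'⟩ := h'
  exact ⟨d + d', fun i => by rw [pow_add]; exact Nat.mul_le_mul (hd i) (hd' i)⟩

theorem PolyBd.add {n n' : ι → ℕ} (h : PolyBd m n) (h' : PolyBd m n') :
    PolyBd m fun i => n i + n' i := by
  obtain ⟨d, hd⟩ := h
  obtain ⟨d', hd'⟩ := h'
  refine ⟨d + d' + 1, fun i => ?_⟩
  have h1 : (m i + 2) ^ d ≤ (m i + 2) ^ (d + d') := Nat.pow_le_pow_right (by omega) (by omega)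
  have h2 : (m i + 2) ^ d' ≤ (m i + 2) ^ (d + d') := Nat.pow_le_pow_right (by omega) (by omega)
  calc n i + n' i ≤ (m i + 2) ^ (d + d') * 2 := by have := hd i; have := hd' i; omega
    _ ≤ _ := by rw [pow_succ]; exact Nat.mul_le_mul_left _ (by omega)

theorem PolyBd.pow {n : ι → ℕ} (h : PolyBd m n) (e : ℕ) : PolyBd m fun i => n i ^ e := by
  obtain ⟨d, hd⟩ := h
  exact ⟨d * e, fun i => by rw [pow_mul]; exact Nat.pow_le_pow_left (hd i) e⟩

theorem PolyBd.reindex {n : ι → ℕ} (h : PolyBd m n) (π : κ → ι) :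
    PolyBd (fun q => m (π q)) fun q => n (π q) := by
  obtain ⟨d, hd⟩ := h
  exact ⟨d, fun q => hd _⟩

/-- A single program computes `y i` from `x i`, deterministically and in time polynomial in the
measure `m i`, for all indices `i`. -/
def Computes (m : ι → ℕ) (x y : ι → Val) : Prop :=
  ∃ (c : Code) (t : ι → ℕ), PolyBd m t ∧ ∀ i, Eval c (x i) [] (y i) (t i)

variable {x y z : ι → Val}

theorem Computes.congr {y' : ι → Val} (h : Computes m x y) (hy : ∀ i, y i = y' i) :
    Computes m x y' := by
  rwa [← funext hy]

/-- Indices may be repeated or dropped. A bound variable is therefore modelled by passing to a sigma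
type of indices and pushing its value on the environment. -/
theorem Computes.reindex (h : Computes m x y) (π : κ → ι) :
    Computes (fun q => m (π q)) (fun q => x (π q)) fun q => y (π q) := by
  obtain ⟨c, t, ht, h⟩ := h
  exact ⟨c, _, ht.reindex π, fun q => h _⟩

theorem Computes.comp (h : Computes m x y) (h' : Computes m y z) : Computes m x z := by
  obtain ⟨c, t, ht, h⟩ := h
  obtain ⟨c', t', ht', h'⟩ := h'
  exact ⟨.comp c' c, _, (ht.add ht').add (.const 1), fun i => by simpa using (h i).comp (h' i)⟩

theorem Computes.pair (h : Computes m x y) (h' : Computes m x z) :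
    Computes m x fun i => .pair (y i) (z i) := by
  obtain ⟨c, t, ht, h⟩ := h
  obtain ⟨c', t', ht', h'⟩ := h'
  exact ⟨.pair c c', _, (ht.add ht').add (.const 1), fun i => by simpa using (h i).pair (h' i)⟩

theorem Computes.apply (h : Computes m x y) (p : Prim) :
    Computes m x fun i => p.apply (y i) :=
  h.comp ⟨.prim p, _, .const 1, fun _ => .prim p _⟩

theorem Computes.id : Computes m x x := ⟨.prim .id, _, .const 1, fun _ => .prim .id _⟩

theorem Computes.fst (h : Computes m x fun i => .pair (y i) (z i)) : Computes m x y := h.apply .fst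

theorem Computes.snd (h : Computes m x fun i => .pair (y i) (z i)) : Computes m x z := h.apply .snd

theorem Computes.nil : Computes m x fun _ => .nil :=
  (Computes.id.apply .nil).congr fun i => by cases x i <;> rfl

theorem Computes.one : Computes m x fun _ => .real 1 :=
  (Computes.id.apply .one).congr fun i => by cases x i <;> rfl

/-- Push a further value on the environment. -/
theorem Computes.weaken (h : Computes m x y) (π : κ → ι) (w : κ → Val) :
    Computes (fun q => m (π q)) (fun q => .pair (w q) (x (π q))) fun q => y (π q) :=
  (Computes.id.snd).comp (h.reindex π)

theorem Computes.var {m : κ → ℕ} {w x : κ → Val} :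
    Computes m (fun q => .pair (w q) (x q)) w := Computes.id.fst

section Real

variable {a b : ι → ℝ}

theorem Computes.add (ha : Computes m x fun i => .real (a i)) (hb : Computes m x fun i => .real (b i)) :
    Computes m x fun i => .real (a i + b i) := (ha.pair hb).apply .add

theorem Computes.sub (ha : Computes m x fun i => .real (a i)) (hb : Computes m x fun i => .real (b i)) :
    Computes m x fun i => .real (a i - b i) := (ha.pair hb).apply .sub

theorem Computes.mul (ha : Computes m x fun i => .real (a i)) (hb : Computes m x fun i => .real (b i)) :
    Computes m x fun i => .real (a i * b i) := (ha.pair hb).apply .mul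

theorem Computes.div (ha : Computes m x fun i => .real (a i)) (hb : Computes m x fun i => .real (b i)) :
    Computes m x fun i => .real (a i / b i) := (ha.pair hb).apply .div

theorem Computes.natCast (n : ℕ) : Computes m x fun _ => .real n := by
  induction n with
  | zero => exact (Computes.one.sub Computes.one).congr fun i => by simp
  | succ n ih => exact (ih.add Computes.one).congr fun i => by simp

end Real

/-- The truth value of a proposition. -/
noncomputable def Val.ofProp (p : Prop) : Val := by
  classical exact Val.ofBool (decide p)

theorem Val.ofProp_true {p : Prop} (h : p) : Val.ofProp p = .pair .nil .nil := by
  simp [Val.ofProp, h, Val.ofBool]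

theorem Val.ofProp_false {p : Prop} (h : ¬ p) : Val.ofProp p = .nil := by
  simp [Val.ofProp, h, Val.ofBool]

theorem Val.ofProp_ne_nil {p : Prop} : Val.ofProp p ≠ .nil ↔ p := by
  by_cases h : p
  · simp [Val.ofProp_true, h]
  · simp [Val.ofProp_false, h]

variable {p q : ι → Prop}

theorem Computes.le {a b : ι → ℝ} (ha : Computes m x fun i => .real (a i))
    (hb : Computes m x fun i => .real (b i)) :
    Computes m x fun i => .ofProp (a i ≤ b i) := (ha.pair hb).apply .le

theorem Computes.ite [∀ i, Decidable (p i)] (hp : Computes m x fun i => .ofProp (p i))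
    (hy : Computes m x y) (hz : Computes m x z) :
    Computes m x fun i => if p i then y i else z i := by
  obtain ⟨c, t, ht, hp⟩ := hp
  obtain ⟨c1, t1, ht1, hy⟩ := hy
  obtain ⟨c2, t2, ht2, hz⟩ := hz
  refine ⟨.cond c c1 c2, fun i => t i + (if p i then t1 i else t2 i) + 1,
    ((ht.add (ht1.add ht2)).add (.const 1)).mono fun i => ?_, fun i => ?_⟩
  · split_ifs <;> omega
  · have := hp i
    by_cases h : p i
    · simp only [h, if_true]
      simpa using this.cond_true (Val.ofProp_ne_nil.2 h) (hy i)
    · simp only [h, if_false]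
      simp only [Val.ofProp_false h] at this
      simpa using this.cond_false (hz i)

theorem Computes.ite_apply {α : ι → Type*} {e : ∀ i, α i → Val} {a b : ∀ i, α i}
    [∀ i, Decidable (p i)] (hp : Computes m x fun i => .ofProp (p i))
    (hy : Computes m x fun i => e i (a i)) (hz : Computes m x fun i => e i (b i)) :
    Computes m x fun i => e i (if p i then a i else b i) :=
  (hp.ite hy hz).congr fun i => by split_ifs <;> rfl

theorem Computes.not (hp : Computes m x fun i => .ofProp (p i)) :
    Computes m x fun i => .ofProp (¬ p i) := by
  classical
  refine (hp.ite Computes.nil (Computes.nil.pair Computes.nil)).congr fun i => ?_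
  split_ifs with h
  · rw [Val.ofProp_false (by simpa using h)]
  · rw [Val.ofProp_true h]

theorem Computes.and (hp : Computes m x fun i => .ofProp (p i))
    (hq : Computes m x fun i => .ofProp (q i)) :
    Computes m x fun i => .ofProp (p i ∧ q i) := by
  classical
  refine (hp.ite hq Computes.nil).congr fun i => ?_
  split_ifs with h
  · simp [h]
  · rw [Val.ofProp_false (by tauto)]

theorem Computes.or (hp : Computes m x fun i => .ofProp (p i))
    (hq : Computes m x fun i => .ofProp (q i)) :
    Computes m x fun i => .ofProp (p i ∨ q i) :=
  (hp.not.and hq.not).not.congr fun i => by congr 1; simp only [eq_iff_iff]; tauto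

theorem Computes.eq_nat {a b : ι → ℕ} (ha : Computes m x fun i => .real (a i))
    (hb : Computes m x fun i => .real (b i)) :
    Computes m x fun i => .ofProp (a i = b i) :=
  ((ha.le hb).and (hb.le ha)).congr fun i => by
    congr 1; simp only [eq_iff_iff, Nat.cast_le]; omega

/-- Induction backwards from the final state, since `Eval.loop_step` prepends a round. A round costs
one test, one body and one step, at most `2 * B + 1`. -/
theorem Eval.loop_bound {c f : Code} {s b : ℕ → Val} {N B : ℕ} {t t' : ℕ → ℕ}
    (htest : ∀ j ≤ N, Eval c (s j) [] (b j) (t j)) (hb : ∀ j < N, b j ≠ .nil) (hN : b N = .nil)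
    (hbody : ∀ j < N, Eval f (s j) [] (s (j + 1)) (t' j)) (ht : ∀ j ≤ N, t j ≤ B)
    (ht' : ∀ j < N, t' j ≤ B) :
    ∃ r, Eval (.loop c f) (s 0) [] (s N) r ∧ r ≤ (N + 1) * (2 * B + 1) := by
  have key : ∀ r ≤ N, ∃ T, Eval (.loop c f) (s (N - r)) [] (s N) T ∧
      T ≤ (r + 1) * (2 * B + 1) := by
    intro r
    induction r with
    | zero =>
      intro _
      have h := htest N le_rfl
      rw [hN] at h
      have := ht N le_rfl
      have hs : Eval (.loop c f) (s N) [] (s N) (t N + 1) := by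
        constructor
        exact h
      exact ⟨_, hs, by omega⟩
    | succ r ih =>
      intro hr
      obtain ⟨T, hT, hTB⟩ := ih (by omega)
      have h1 := htest (N - (r + 1)) (by omega)
      have h2 := hbody (N - (r + 1)) (by omega)
      rw [show N - (r + 1) + 1 = N - r by omega] at h2
      have h3 := ht (N - (r + 1)) (by omega)
      have h4 := ht' (N - (r + 1)) (by omega)
      refine ⟨_, .loop_step h1 (hb _ (by omega)) h2 hT, ?_⟩
      rw [add_mul]
      omega
  simpa using key N le_rfl

/-- Iteration: the number of rounds is polynomially bounded, and test and body are computable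
uniformly on all states that occur. -/
theorem Computes.loop {s b : ι → ℕ → Val} {N : ι → ℕ} (hN : PolyBd m N)
    (htest : Computes (fun q : Σ i, Fin (N i + 1) => m q.1) (fun q => s q.1 q.2)
      fun q => b q.1 q.2)
    (hb : ∀ i, ∀ j < N i, b i j ≠ .nil) (hbN : ∀ i, b i (N i) = .nil)
    (hbody : Computes (fun q : Σ i, Fin (N i) => m q.1) (fun q => s q.1 q.2)
      fun q => s q.1 (q.2 + 1)) :
    Computes m (fun i => s i 0) fun i => s i (N i) := by
  obtain ⟨c, t, ⟨d, ht⟩, h⟩ := htest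
  obtain ⟨f, t', ⟨d', ht'⟩, h'⟩ := hbody
  have key : ∀ i, ∃ r, Eval (.loop c f) (s i 0) [] (s i (N i)) r ∧
      r ≤ (N i + 1) * (2 * ((m i + 2) ^ d + (m i + 2) ^ d') + 1) := by
    intro i
    -- The times are given on the sigma types only; the value zero outside their range is never
    -- used.
    refine Eval.loop_bound (b := b i)
      (t := fun j => if hj : j ≤ N i then t ⟨i, j, by omega⟩ else 0)
      (t' := fun j => if hj : j < N i then t' ⟨i, j, hj⟩ else 0) ?_ (hb i) (hbN i) ?_ ?_ ?_
    · intro j hj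
      simpa [hj] using h ⟨i, j, by omega⟩
    · intro j hj
      simpa [hj] using h' ⟨i, j, hj⟩
    · intro j hj
      simpa [hj] using (ht ⟨i, j, by omega⟩).trans (Nat.le_add_right _ _)
    · intro j hj
      simpa [hj] using (ht' ⟨i, j, hj⟩).trans (Nat.le_add_left _ _)
  choose r hr hrb using key
  have hM (e : ℕ) : PolyBd m fun i => (m i + 2) ^ e := ⟨e, fun i => le_rfl⟩
  exact ⟨.loop c f, r, ((hN.add (.const 1)).mul
    (((PolyBd.const 2).mul ((hM d).add (hM d'))).add (.const 1))).mono hrb, hr⟩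

/-- The encoding of a list, given an encoding of its elements. -/
def Val.ofListMap {α : Type*} (e : α → Val) (l : List α) : Val := Val.ofList (l.map e)

/-- A program computes a list of polynomially bounded length. -/
def ComputesList {β : ι → Type*} (m : ι → ℕ) (x : ι → Val) (e : ∀ i, β i → Val)
    (l : ∀ i, List (β i)) : Prop :=
  Computes m x (fun i => Val.ofListMap (e i) (l i)) ∧ PolyBd m fun i => (l i).length

/-! ### Programs on lists. -/

section Lists

variable {β σ : ι → Type} {eb : ∀ i, β i → Val} {es : ∀ i, σ i → Val}

theorem ComputesList.weaken {l : ∀ i, List (β i)} (h : ComputesList m x eb l) (π : κ → ι)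
    (w : κ → Val) :
    ComputesList (fun q => m (π q)) (fun q => .pair (w q) (x (π q))) (fun q => eb (π q))
      fun q => l (π q) :=
  ⟨h.1.weaken π w, h.2.reindex π⟩

/-- The loop carries the unread rest of the list, the environment and the accumulator. The rest
serves as its own loop test, being `nil` exactly at the end. The body has to handle only
accumulators that occur. -/
theorem Computes.foldl_reach {l : ∀ i, List (β i)} {f : ∀ i, σ i → β i → σ i} {s : ∀ i, σ i}
    (hl : ComputesList m x eb l) (hs : Computes m x fun i => es i (s i))
    (hf : Computes (fun q : Σ i, Fin (l i).length => m q.1)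
      (fun q => .pair (es q.1 (((l q.1).take q.2).foldl (f q.1) (s q.1)))
        (.pair (eb q.1 ((l q.1)[q.2])) (x q.1)))
      fun q => es q.1 (f q.1 (((l q.1).take q.2).foldl (f q.1) (s q.1)) ((l q.1)[q.2]))) :
    Computes m x fun i => es i ((l i).foldl (f i) (s i)) := by
  let st : ι → ℕ → Val := fun i j =>
    .pair (.pair (Val.ofListMap (eb i) ((l i).drop j)) (x i))
      (es i (((l i).take j).foldl (f i) (s i)))
  have h0 : Computes m x fun i => st i 0 := by
    refine ((hl.1.pair Computes.id).pair hs).congr fun i => ?_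
    simp [st]
  have hloop : Computes m (fun i => st i 0) fun i => st i (l i).length := by
    refine Computes.loop (b := fun i j => Val.ofListMap (eb i) ((l i).drop j)) hl.2 ?_ ?_ ?_ ?_
    · exact Computes.id.fst.fst
    · intro i j hj
      simp only [List.drop_eq_getElem_cons hj]
      exact Val.noConfusion
    · intro i
      simp [Val.ofListMap, Val.ofList]
    · have hst : ∀ q : Σ i, Fin (l i).length, st q.1 q.2 =
          .pair (.pair (.pair (eb q.1 ((l q.1)[q.2]))
            (Val.ofListMap (eb q.1) ((l q.1).drop (q.2 + 1)))) (x q.1))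
            (es q.1 (((l q.1).take q.2).foldl (f q.1) (s q.1))) := by
        intro q
        simp only [st]
        rw [List.drop_eq_getElem_cons q.2.2]
        rfl
      have hst' : ∀ q : Σ i, Fin (l i).length, st q.1 (q.2 + 1) =
          .pair (.pair (Val.ofListMap (eb q.1) ((l q.1).drop (q.2 + 1))) (x q.1))
            (es q.1 (f q.1 (((l q.1).take q.2).foldl (f q.1) (s q.1)) ((l q.1)[q.2]))) := by
        intro q
        simp only [st]
        rw [List.take_succ_eq_append_getElem q.2.2, List.foldl_append]
        rfl
      rw [funext hst, funext hst']
      have hid := Computes.id (m := fun q : Σ i, Fin (l i).length => m q.1)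
        (x := fun q => Val.pair (.pair (.pair (eb q.1 ((l q.1)[q.2]))
            (Val.ofListMap (eb q.1) ((l q.1).drop (q.2 + 1)))) (x q.1))
            (es q.1 (((l q.1).take q.2).foldl (f q.1) (s q.1))))
      exact (hid.fst.fst.snd.pair hid.fst.snd).pair
        ((hid.snd.pair (hid.fst.fst.fst.pair hid.fst.snd)).comp hf)
  refine ((h0.comp hloop).snd).congr fun i => ?_
  simp

theorem Computes.foldl {l : ∀ i, List (β i)} {f : ∀ i, σ i → β i → σ i} {s : ∀ i, σ i}
    (hl : ComputesList m x eb l) (hs : Computes m x fun i => es i (s i))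
    (hf : Computes (fun q : Σ i, σ i × β i => m q.1)
      (fun q => .pair (es q.1 q.2.1) (.pair (eb q.1 q.2.2) (x q.1)))
      fun q => es q.1 (f q.1 q.2.1 q.2.2)) :
    Computes m x fun i => es i ((l i).foldl (f i) (s i)) :=
  Computes.foldl_reach hl hs (hf.reindex fun q : Σ i, Fin (l i).length =>
    ⟨q.1, ((l q.1).take q.2).foldl (f q.1) (s q.1), (l q.1)[q.2]⟩)

theorem ComputesList.nil : ComputesList m x eb fun _ => [] :=
  ⟨Computes.nil, .const 0⟩

theorem ComputesList.cons {a : ∀ i, β i} {l : ∀ i, List (β i)}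
    (ha : Computes m x fun i => eb i (a i)) (hl : ComputesList m x eb l) :
    ComputesList m x eb fun i => a i :: l i :=
  ⟨ha.pair hl.1, (hl.2.add (.const 1)).mono fun i => by simp⟩

theorem ComputesList.ite {p : ι → Prop} [∀ i, Decidable (p i)] {l l' : ∀ i, List (β i)}
    (hp : Computes m x fun i => .ofProp (p i)) (hl : ComputesList m x eb l)
    (hl' : ComputesList m x eb l') : ComputesList m x eb fun i => if p i then l i else l' i :=
  ⟨(hp.ite hl.1 hl'.1).congr fun i => by dsimp only; split_ifs <;> rfl,
    (hl.2.add hl'.2).mono fun i => by dsimp only; split_ifs <;> omega⟩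

/-- Prepending the reversed list takes time independent of the length of the second list. -/
theorem Computes.reverse_append {l l' : ∀ i, List (β i)} (hl : ComputesList m x eb l)
    (hl' : Computes m x fun i => Val.ofListMap (eb i) (l' i)) :
    Computes m x fun i => Val.ofListMap (eb i) ((l i).reverse ++ l' i) := by
  refine (Computes.foldl (σ := fun i => List (β i)) (es := fun i => Val.ofListMap (eb i))
    (f := fun _ acc b => b :: acc) hl hl' ?_).congr fun i => ?_
  · exact Computes.id.snd.fst.pair Computes.id.fst
  · rw [List.foldl_flip_cons_eq_append']

theorem ComputesList.reverse {l : ∀ i, List (β i)} (hl : ComputesList m x eb l) :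
    ComputesList m x eb fun i => (l i).reverse :=
  ⟨(Computes.reverse_append hl ComputesList.nil.1).congr fun i => by simp, by simpa using hl.2⟩

theorem ComputesList.append {l l' : ∀ i, List (β i)} (hl : ComputesList m x eb l)
    (hl' : ComputesList m x eb l') : ComputesList m x eb fun i => l i ++ l' i :=
  ⟨(Computes.reverse_append hl.reverse hl'.1).congr fun i => by simp,
    by simpa using hl.2.add hl'.2⟩

/-- The result is accumulated in reverse and reversed once at the end: `Computes.foldl` asks for a
time bound uniform over all accumulators, which prepending satisfies and appending at the end would
not. -/
theorem ComputesList.flatMap {γ : ι → Type} {eg : ∀ i, γ i → Val} {l : ∀ i, List (β i)}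
    {f : ∀ i, β i → List (γ i)} (hl : ComputesList m x eb l)
    (hf : ComputesList (fun q : Σ i, β i => m q.1) (fun q => .pair (eb q.1 q.2) (x q.1))
      (fun q => eg q.1) fun q => f q.1 q.2) :
    ComputesList m x eg fun i => (l i).flatMap (f i) := by
  have hlen : PolyBd m fun i => ((l i).flatMap (f i)).length := by
    obtain ⟨d, hd⟩ := hf.2
    refine (hl.2.mul ⟨d, fun i => le_rfl⟩).mono fun i => ?_
    rw [List.length_flatMap]
    refine (List.sum_le_card_nsmul _ ((m i + 2) ^ d) ?_).trans (by simp)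
    intro n hn
    obtain ⟨b, _, rfl⟩ := List.mem_map.1 hn
    exact hd ⟨i, b⟩
  have hrev : ComputesList m x eg fun i => ((l i).flatMap (f i)).reverse := by
    refine ⟨?_, by simpa using hlen⟩
    refine (Computes.foldl (σ := fun i => List (γ i)) (es := fun i => Val.ofListMap (eg i))
      (f := fun i acc b => (f i b).reverse ++ acc) (s := fun _ => []) hl ComputesList.nil.1
      ?_).congr fun i => ?_
    · refine Computes.reverse_append ?_ Computes.var
      refine ⟨Computes.id.snd.comp
        (hf.1.reindex fun q : Σ i, List (γ i) × β i => (⟨q.1, q.2.2⟩ : Σ i, β i)),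
        hf.2.reindex fun q : Σ i, List (γ i) × β i => (⟨q.1, q.2.2⟩ : Σ i, β i)⟩
    · congr 1
      have : ∀ (l : List (β i)) acc, l.foldl (fun acc b => (f i b).reverse ++ acc) acc =
          (l.flatMap (f i)).reverse ++ acc := by
        intro l
        induction l with
        | nil => simp
        | cons a l ih => intro acc; simp [ih]
      simpa using this (l i) []
  simpa using hrev.reverse

theorem ComputesList.map {γ : ι → Type} {eg : ∀ i, γ i → Val} {l : ∀ i, List (β i)}
    {f : ∀ i, β i → γ i} (hl : ComputesList m x eb l)
    (hf : Computes (fun q : Σ i, β i => m q.1) (fun q => .pair (eb q.1 q.2) (x q.1))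
      fun q => eg q.1 (f q.1 q.2)) :
    ComputesList m x eg fun i => (l i).map (f i) := by
  have h := hl.flatMap (f := fun i b => [f i b]) (eg := eg)
    (ComputesList.cons (eb := fun q : Σ i, β i => eg q.1) (a := fun q => f q.1 q.2) hf .nil)
  simpa only [List.map_eq_flatMap] using h

theorem ComputesList.filter {l : ∀ i, List (β i)} {p : ∀ i, β i → Prop}
    [∀ i, DecidablePred (p i)] (hl : ComputesList m x eb l)
    (hp : Computes (fun q : Σ i, β i => m q.1) (fun q => .pair (eb q.1 q.2) (x q.1))
      fun q => .ofProp (p q.1 q.2)) :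
    ComputesList m x eb fun i => (l i).filter (p i ·) := by
  have h := hl.flatMap (f := fun i b => if p i b then [b] else []) (eg := eb)
    (ComputesList.ite hp (ComputesList.cons (eb := fun q : Σ i, β i => eb q.1)
      (a := fun q => q.2) Computes.var .nil) .nil)
  have heq : ∀ i, (l i).flatMap (fun b => if p i b then [b] else []) =
      (l i).filter (p i ·) := by
    intro i
    induction l i with
    | nil => simp
    | cons a l ih => by_cases h : p i a <;> simp [h, ih]
  simpa only [heq] using h

/-- Traverse a list, keeping the element with the larger key. -/
noncomputable def pick {α : Type*} (key : α → ℝ) (a : α) (l : List α) : α := by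
  classical exact l.foldl (fun a b => if key b ≤ key a then a else b) a

theorem pick_mem {α : Type*} (key : α → ℝ) (a : α) (l : List α) : pick key a l ∈ a :: l := by
  classical
  unfold pick
  induction l generalizing a with
  | nil => simp
  | cons b l ih =>
    rw [List.foldl_cons]
    split_ifs
    · have := ih a
      simp only [List.mem_cons] at this ⊢
      tauto
    · have := ih b
      simp only [List.mem_cons] at this ⊢
      tauto

theorem le_pick {α : Type*} (key : α → ℝ) (a : α) (l : List α) {b : α} (hb : b ∈ a :: l) :
    key b ≤ key (pick key a l) := by
  classical
  unfold pick
  induction l generalizing a b with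
  | nil => simp_all
  | cons c l ih =>
    rw [List.foldl_cons]
    have h1 := ih (if key c ≤ key a then a else c) (List.mem_cons_self ..)
    simp only [List.mem_cons] at hb
    rcases hb with rfl | rfl | hb
    · refine le_trans ?_ h1
      split_ifs with h
      · exact le_rfl
      · exact (not_le.1 h).le
    · refine le_trans ?_ h1
      split_ifs with h
      · exact h
      · exact le_rfl
    · exact ih _ (List.mem_cons_of_mem _ hb)

theorem Computes.pick {l : ∀ i, List (β i)} {key : ∀ i, β i → ℝ} {a : ∀ i, β i}
    (hl : ComputesList m x eb l) (ha : Computes m x fun i => eb i (a i))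
    (hk : Computes (fun q : Σ i, β i => m q.1) (fun q => .pair (eb q.1 q.2) (x q.1))
      fun q => .real (key q.1 q.2)) :
    Computes m x fun i => eb i (KMedian.pick (key i) (a i) (l i)) := by
  classical
  unfold KMedian.pick
  refine Computes.foldl (f := fun i a b => if key i b ≤ key i a then a else b) hl ha ?_
  refine Computes.ite_apply (α := fun q : Σ i, β i × β i => β q.1) (e := fun q => eb q.1) ?_
    Computes.id.fst Computes.id.snd.fst
  refine Computes.le ?_ ?_
  · exact Computes.id.snd.comp
      (hk.reindex fun q : Σ i, β i × β i => (⟨q.1, q.2.2⟩ : Σ i, β i))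
  · exact (Computes.id.fst.pair Computes.id.snd.snd).comp
      (hk.reindex fun q : Σ i, β i × β i => (⟨q.1, q.2.1⟩ : Σ i, β i))

theorem Computes.sum_list {l : ∀ i, List (β i)} {g : ∀ i, β i → ℝ}
    (hl : ComputesList m x eb l)
    (hg : Computes (fun q : Σ i, β i => m q.1) (fun q => .pair (eb q.1 q.2) (x q.1))
      fun q => .real (g q.1 q.2)) :
    Computes m x fun i => .real ((l i).map (g i)).sum := by
  refine (Computes.foldl (σ := fun _ => ℝ) (es := fun _ => Val.real)
    (f := fun i s b => s + g i b) (s := fun _ => 0) hl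
    ((Computes.natCast 0).congr fun i => by simp) ?_).congr fun i => ?_
  · exact Computes.id.fst.add (Computes.id.snd.comp
      (hg.reindex fun q : Σ i, ℝ × β i => (⟨q.1, q.2.2⟩ : Σ i, β i)))
  · congr 1
    have : ∀ (l : List (β i)) (s : ℝ), l.foldl (fun s b => s + g i b) s = s + (l.map (g i)).sum := by
      intro l
      induction l with
      | nil => simp
      | cons a l ih => intro s; simp [ih, add_assoc]
    simpa using this (l i) 0

theorem Computes.length {l : ∀ i, List (β i)} (hl : ComputesList m x eb l) :
    Computes m x fun i => .real (l i).length :=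
  (Computes.sum_list (g := fun _ _ => 1) hl Computes.one).congr fun i => by simp

end Lists

end Calculus

/-! ## The greedy algorithm -/

namespace Instance

variable (I : Instance.{u})

/-- Clients and facility locations, in this order. -/
abbrev Pt : Type := Fin (I.numClients + I.numFacilities)

/-- The position of a point. -/
def pt (p : I.Pt) : I.X := Fin.append I.client I.facility p

/-- The distance between a point and a facility location. -/
noncomputable def d (p : I.Pt) (f : Fin I.numFacilities) : ℝ := dist (I.pt p) (I.facility f)

/-- A client as a point. -/
abbrev cl (c : Fin I.numClients) : I.Pt := Fin.castAdd _ c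

/-- A facility location as a point. -/
abbrev fc (f : Fin I.numFacilities) : I.Pt := Fin.natAdd _ f

/-- The first facility location. -/
def fac0 : Fin I.numFacilities := ⟨0, I.k_pos.trans_le I.k_le⟩

section Defs

open Classical

variable (η θ : ℝ) (T : List I.Pt)

/-- The number of clients outside `T` in the ball around `f` with `y` on its boundary. -/
noncomputable def rem (f : Fin I.numFacilities) (y : Fin I.numClients) : ℝ :=
  ∑ c : Fin I.numClients, if I.d (I.cl c) f ≤ I.d (I.cl y) f ∧ ¬ I.cl c ∈ T then 1 else 0

/-- The enlarged radius of the ball around `f` with `y` on its boundary. -/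
noncomputable def rad (f : Fin I.numFacilities) (y : Fin I.numClients) : ℝ :=
  (1 + 2 * η) * (I.d (I.cl y) f + θ / I.rem T f y)

/-- The number of points of `T` in the enlarged ball. -/
noncomputable def hits (f : Fin I.numFacilities) (y : Fin I.numClients) : ℝ :=
  ∑ p : I.Pt, if p ∈ T ∧ I.d p f ≤ I.rad η θ T f y then 1 else 0

/-- A ball that contains clients outside `T` and has not been hit `2k` times. -/
def Active (f : Fin I.numFacilities) (y : Fin I.numClients) : Prop :=
  1 ≤ I.rem T f y ∧ I.hits η θ T f y + 1 ≤ 2 * I.k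

/-- The number of active balls that a new point hits. -/
noncomputable def score (p : I.Pt) : ℝ :=
  ∑ f : Fin I.numFacilities, ∑ y : Fin I.numClients,
    if I.Active η θ T f y ∧ ¬ p ∈ T ∧ I.d p f ≤ I.rad η θ T f y then 1 else 0

/-- The result of the given number of greedy rounds. -/
noncomputable def greedy : ℕ → List I.Pt
  | 0 => [I.fc I.fac0]
  | j + 1 => pick (I.score η θ (greedy j)) (I.fc I.fac0) (List.finRange _) :: greedy j

/-- The order of the facility locations by their distance from `p`, with ties broken. -/
def Before (p : I.Pt) (g f : Fin I.numFacilities) : Prop :=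
  I.d p g < I.d p f ∨ (I.d p g ≤ I.d p f ∧ g < f)

/-- The number of facility locations that come before `f`. -/
noncomputable def rank (p : I.Pt) (f : Fin I.numFacilities) : ℝ :=
  ∑ g : Fin I.numFacilities, if I.Before p g f then 1 else 0

/-- The `k` facility locations nearest to `p`. -/
noncomputable def near (p : I.Pt) : List (Fin I.numFacilities) :=
  (List.finRange _).filter fun f => I.rank p f + 1 ≤ I.k

/-- The candidate centers. -/
noncomputable def cands : List (Fin I.numFacilities) := T.flatMap I.near

end Defs

section Basic

@[simp] theorem pt_cl (c : Fin I.numClients) : I.pt (I.cl c) = I.client c := by simp [pt]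

@[simp] theorem pt_fc (f : Fin I.numFacilities) : I.pt (I.fc f) = I.facility f := by simp [pt]

theorem d_nonneg (p : I.Pt) (f : Fin I.numFacilities) : 0 ≤ I.d p f := dist_nonneg

end Basic

/-! ### The `k` nearest facility locations. -/

section Near

variable {I}

theorem Before.trans {p : I.Pt} {f g h : Fin I.numFacilities} (h1 : I.Before p f g)
    (h2 : I.Before p g h) : I.Before p f h := by
  unfold Before at *
  rcases h1 with h1 | ⟨h1, h1'⟩ <;> rcases h2 with h2 | ⟨h2, h2'⟩
  · exact .inl (h1.trans h2)
  · exact .inl (h1.trans_le h2)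
  · exact .inl (h1.trans_lt h2)
  · exact .inr ⟨h1.trans h2, h1'.trans h2'⟩

theorem Before.irrefl (p : I.Pt) (f : Fin I.numFacilities) : ¬ I.Before p f f := by
  simp [Before]

theorem Before.total (p : I.Pt) {f g : Fin I.numFacilities} (h : f ≠ g) :
    I.Before p f g ∨ I.Before p g f := by
  unfold Before
  rcases lt_trichotomy (I.d p f) (I.d p g) with h1 | h1 | h1
  · tauto
  · rcases lt_or_gt_of_ne h with h2 | h2
    · exact .inl (.inr ⟨h1.le, h2⟩)
    · exact .inr (.inr ⟨h1.ge, h2⟩)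
  · tauto

theorem Before.le {p : I.Pt} {f g : Fin I.numFacilities} (h : I.Before p f g) :
    I.d p f ≤ I.d p g := by
  rcases h with h | h
  · exact h.le
  · exact h.1

open Classical in
theorem rank_eq_card (p : I.Pt) (f : Fin I.numFacilities) :
    I.rank p f = (Finset.univ.filter fun g => I.Before p g f).card := by
  simp [rank]

theorem rank_lt {p : I.Pt} {f g : Fin I.numFacilities} (h : I.Before p f g) :
    I.rank p f < I.rank p g := by
  classical
  rw [rank_eq_card, rank_eq_card, Nat.cast_lt]
  refine Finset.card_lt_card ⟨fun a ha => ?_, fun hs => ?_⟩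
  · simp only [Finset.mem_filter, Finset.mem_univ, true_and] at ha ⊢
    exact ha.trans h
  · have := hs (by simpa using h : f ∈ _)
    simp only [Finset.mem_filter, Finset.mem_univ, true_and] at this
    exact Before.irrefl p f this

theorem mem_near {p : I.Pt} {f : Fin I.numFacilities} : f ∈ I.near p ↔ I.rank p f + 1 ≤ I.k := by
  simp [near]

theorem nodup_near (p : I.Pt) : (I.near p).Nodup := (List.nodup_finRange _).filter _

/-- `Before` is a strict total order, so the rank is an injection of the locations into `Fin
I.numFacilities`, hence a bijection, and exactly `k` ranks lie below `k`. -/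
theorem length_near (p : I.Pt) : (I.near p).length = I.k := by
  classical
  have hlt : ∀ f, (Finset.univ.filter fun g => I.Before p g f).card < I.numFacilities := by
    intro f
    refine (Finset.card_lt_univ_of_notMem (x := f) ?_).trans_eq (Fintype.card_fin _)
    simpa using Before.irrefl p f
  let r : Fin I.numFacilities → Fin I.numFacilities := fun f => ⟨_, hlt f⟩
  have hr : ∀ f, I.rank p f = (r f : ℕ) := rank_eq_card p
  have hinj : Function.Injective r := by
    intro f g hfg
    by_contra h
    have h1 : I.rank p f = I.rank p g := by rw [hr, hr, hfg]
    rcases Before.total p h with h | h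
    · exact (rank_lt h).ne h1
    · exact (rank_lt h).ne' h1
  have hbij : Function.Bijective r := Finite.injective_iff_bijective.1 hinj
  have h1 : (I.near p).length = (Finset.univ.filter fun f => (r f : ℕ) < I.k).card := by
    rw [← List.toFinset_card_of_nodup (nodup_near p)]
    congr 1
    ext f
    simp only [List.mem_toFinset, mem_near, hr, Finset.mem_filter, Finset.mem_univ, true_and]
    norm_cast
  rw [h1]
  have h2 : (Finset.univ.filter fun f => (r f : ℕ) < I.k).card =
      (Finset.univ.filter fun j : Fin I.numFacilities => (j : ℕ) < I.k).card := by
    refine Finset.card_bij (fun f _ => r f) (by simp) (fun a _ b _ h => hinj h) ?_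
    intro b hb
    obtain ⟨a, rfl⟩ := hbij.2 b
    exact ⟨a, by simpa using hb, rfl⟩
  rw [h2, Fin.card_filter_val_lt, min_eq_right I.k_le]

theorem le_of_mem_near {p : I.Pt} {f g : Fin I.numFacilities} (hf : f ∉ I.near p)
    (hg : g ∈ I.near p) : I.d p g ≤ I.d p f := by
  rw [mem_near] at hf hg
  by_cases h : f = g
  · rw [h]
  rcases Before.total p h with h | h
  · have := rank_lt h
    linarith
  · exact h.le

/-- Facility locations are distinct points, so no other one is at distance zero and `f` has rank
zero. -/
theorem mem_near_of_pt_eq {p : I.Pt} {f : Fin I.numFacilities} (h : I.pt p = I.facility f) :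
    f ∈ I.near p := by
  classical
  rw [mem_near]
  have h0 : I.rank p f = 0 := by
    rw [rank_eq_card, Nat.cast_eq_zero, Finset.card_eq_zero, Finset.filter_eq_empty_iff]
    intro g _ hg
    have hf0 : I.d p f = 0 := by rw [d, h, dist_self]
    have h1 := hg.le
    rw [hf0] at h1
    have h2 : I.d p g = 0 := le_antisymm h1 (I.d_nonneg p g)
    have h3 : g = f := by
      rw [d, h, dist_eq_zero] at h2
      exact I.facility.injective h2.symm
    exact Before.irrefl p f (h3 ▸ hg)
  rw [h0, zero_add]
  exact_mod_cast I.k_pos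

theorem near_subset_cands {T : List I.Pt} {p : I.Pt} (hp : p ∈ T) : I.near p ⊆ I.cands T :=
  fun _ hf => List.mem_flatMap.2 ⟨p, hp, hf⟩

theorem length_cands (T : List I.Pt) : (I.cands T).length = T.length * I.k := by
  simp [cands, List.length_flatMap, length_near]

end Near

/-! ### Decrease of the potential under greedy choices. -/

section Greedy

variable {I} {η θ : ℝ} {T : List I.Pt} {p : I.Pt} {f : Fin I.numFacilities} {y : Fin I.numClients}

theorem rem_cons_le : I.rem (p :: T) f y ≤ I.rem T f y := by
  classical
  unfold rem
  refine Finset.sum_le_sum fun c _ => ?_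
  split_ifs with h1 h2
  · exact le_rfl
  · simp only [List.mem_cons] at h1
    tauto
  · norm_num
  · exact le_rfl

/-- Fewer clients outside `T` make `θ / rem` larger: balls only grow along the greedy run, so no hit
is ever lost. The lower bound on `rem` keeps away from division by zero. -/
theorem rad_le_rad_cons (hη : 0 ≤ η) (hθ : 0 ≤ θ) (h : 1 ≤ I.rem (p :: T) f y) :
    I.rad η θ T f y ≤ I.rad η θ (p :: T) f y := by
  unfold rad
  gcongr
  exact rem_cons_le

theorem hits_add_le (hη : 0 ≤ η) (hθ : 0 ≤ θ) (h : 1 ≤ I.rem (p :: T) f y) (hp : p ∉ T)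
    (hd : I.d p f ≤ I.rad η θ T f y) : I.hits η θ T f y + 1 ≤ I.hits η θ (p :: T) f y := by
  classical
  have hr := rad_le_rad_cons hη hθ h
  have h1 : (1 : ℝ) = ∑ q : I.Pt, if q = p then 1 else 0 := by simp
  unfold hits
  rw [h1, ← Finset.sum_add_distrib]
  refine Finset.sum_le_sum fun q _ => ?_
  by_cases hqp : q = p
  · subst hqp
    rw [if_neg (by tauto), if_pos rfl, if_pos ⟨by simp, hd.trans hr⟩]
    norm_num
  · rw [if_neg hqp, add_zero]
    split_ifs with h2 h3
    · exact le_rfl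
    · exact absurd ⟨List.mem_cons_of_mem _ h2.1, h2.2.trans hr⟩ h3
    · norm_num
    · exact le_rfl

theorem hits_le_cons (hη : 0 ≤ η) (hθ : 0 ≤ θ) (h : 1 ≤ I.rem (p :: T) f y) :
    I.hits η θ T f y ≤ I.hits η θ (p :: T) f y := by
  classical
  have hr := rad_le_rad_cons hη hθ h
  unfold hits
  refine Finset.sum_le_sum fun q _ => ?_
  split_ifs with h2 h3
  · exact le_rfl
  · exact absurd ⟨List.mem_cons_of_mem _ h2.1, h2.2.trans hr⟩ h3
  · norm_num
  · exact le_rfl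

theorem hits_nonneg : 0 ≤ I.hits η θ T f y := by
  classical
  unfold hits
  refine Finset.sum_nonneg fun _ _ => ?_
  split_ifs <;> norm_num

/-- How often a ball still has to be hit. -/
noncomputable def deficit (I : Instance.{u}) (η θ : ℝ) (T : List I.Pt) (f : Fin I.numFacilities)
    (y : Fin I.numClients) : ℝ := by
  classical exact if I.Active η θ T f y then 2 * I.k - I.hits η θ T f y else 0

/-- The total deficit. -/
noncomputable def pot (I : Instance.{u}) (η θ : ℝ) (T : List I.Pt) : ℝ :=
  ∑ f, ∑ y, I.deficit η θ T f y

theorem deficit_nonneg : 0 ≤ I.deficit η θ T f y := by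
  classical
  unfold deficit
  split_ifs with h
  · linarith [h.2]
  · exact le_rfl

open Classical in
theorem deficit_le : I.deficit η θ T f y ≤ 2 * I.k * if I.Active η θ T f y then 1 else 0 := by
  unfold deficit
  split_ifs with h
  · linarith [hits_nonneg (η := η) (θ := θ) (T := T) (f := f) (y := y)]
  · simp

-- A ball active afterwards was active before, and a new point inside it adds a hit. A ball that
-- ceases to be active drops from a deficit of at least one to zero.
open Classical in
theorem deficit_cons_le (hη : 0 ≤ η) (hθ : 0 ≤ θ) :
    I.deficit η θ (p :: T) f y ≤ I.deficit η θ T f y -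
      if I.Active η θ T f y ∧ ¬ p ∈ T ∧ I.d p f ≤ I.rad η θ T f y then 1 else 0 := by
  unfold deficit
  by_cases h : I.Active η θ (p :: T) f y
  · have h1 : I.Active η θ T f y :=
      ⟨h.1.trans rem_cons_le, by linarith [h.2, hits_le_cons hη hθ h.1]⟩
    rw [if_pos h, if_pos h1]
    split_ifs with h2
    · linarith [hits_add_le hη hθ h.1 h2.2.1 h2.2.2]
    · linarith [hits_le_cons hη hθ h.1]
  · rw [if_neg h]
    split_ifs with h1 h2 h2
    · linarith [h1.2]
    · linarith [h1.2]
    · exact absurd h2.1 h1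
    · simp

theorem pot_cons_le (hη : 0 ≤ η) (hθ : 0 ≤ θ) :
    I.pot η θ (p :: T) ≤ I.pot η θ T - I.score η θ T p := by
  classical
  unfold pot score
  rw [← Finset.sum_sub_distrib]
  refine Finset.sum_le_sum fun f _ => ?_
  rw [← Finset.sum_sub_distrib]
  exact Finset.sum_le_sum fun y _ => deficit_cons_le hη hθ

theorem pot_le_card : I.pot η θ T ≤ 2 * I.k * I.numFacilities * I.numClients := by
  classical
  calc I.pot η θ T ≤ ∑ f : Fin I.numFacilities, ∑ y : Fin I.numClients, (2 * I.k : ℝ) := by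
        refine Finset.sum_le_sum fun f _ => Finset.sum_le_sum fun y _ => ?_
        refine deficit_le.trans ?_
        split_ifs
        · simp
        · simp
    _ = _ := by simp; ring

theorem not_active_of_pot_lt (h : I.pot η θ T < 1) : ¬ I.Active η θ T f y := by
  classical
  intro ha
  have h1 : I.deficit η θ T f y ≤ I.pot η θ T := by
    refine (Finset.single_le_sum (f := fun y => I.deficit η θ T f y)
      (fun y _ => deficit_nonneg) (Finset.mem_univ y)).trans ?_
    exact Finset.single_le_sum (f := fun f => ∑ y, I.deficit η θ T f y)
      (fun f _ => Finset.sum_nonneg fun y _ => deficit_nonneg) (Finset.mem_univ f)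
  rw [deficit, if_pos ha] at h1
  linarith [ha.2]

/-- A measure of total mass `W` that gives mass at least one to the unhit part of every active
ball. -/
def IsFractionalHitting (I : Instance.{u}) (η θ W : ℝ) (μ : I.Pt → ℝ) : Prop := by
  classical exact (∀ p, 0 ≤ μ p) ∧ ∑ p, μ p ≤ W ∧ ∀ T f y, I.Active η θ T f y →
    1 ≤ ∑ p, μ p * if ¬ p ∈ T ∧ I.d p f ≤ I.rad η θ T f y then 1 else 0

/-- Averaging: by double counting, the scores weighted by `μ` sum to at least the number of active
balls, so the best score is at least that number divided by `W`. Each active ball has deficit at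
most `2k`. The measure enters the analysis only; the greedy choice does not depend on it. -/
theorem pot_greedy_succ_le (hη : 0 ≤ η) (hθ : 0 ≤ θ) {W β : ℝ} {μ : I.Pt → ℝ}
    (hμ : I.IsFractionalHitting η θ W μ) (hβ0 : 0 ≤ β) (hβ : β * (2 * I.k * W) ≤ 1) (j : ℕ) :
    I.pot η θ (I.greedy η θ (j + 1)) ≤ (1 - β) * I.pot η θ (I.greedy η θ j) := by
  classical
  obtain ⟨h0, hW, hact⟩ := hμ
  rw [greedy]
  set T := I.greedy η θ j
  set b := pick (I.score η θ T) (I.fc I.fac0) (List.finRange _)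
  have hb : ∀ p, I.score η θ T p ≤ I.score η θ T b := fun p => le_pick _ _ _ (by simp)
  have hb0 : 0 ≤ I.score η θ T b := by
    unfold score
    refine Finset.sum_nonneg fun _ _ => Finset.sum_nonneg fun _ _ => ?_
    split_ifs <;> norm_num
  have h1 : (∑ f, ∑ y, if I.Active η θ T f y then (1 : ℝ) else 0) ≤
      ∑ p, μ p * I.score η θ T p := by
    have hswap : ∑ p, μ p * I.score η θ T p = ∑ f, ∑ y, ∑ p, μ p *
        if I.Active η θ T f y ∧ ¬ p ∈ T ∧ I.d p f ≤ I.rad η θ T f y then 1 else 0 := by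
      unfold score
      simp only [Finset.mul_sum]
      rw [Finset.sum_comm]
      exact Finset.sum_congr rfl fun f _ => Finset.sum_comm
    rw [hswap]
    refine Finset.sum_le_sum fun f _ => Finset.sum_le_sum fun y _ => ?_
    by_cases ha : I.Active η θ T f y
    · rw [if_pos ha]
      refine (hact T f y ha).trans (le_of_eq (Finset.sum_congr rfl fun p _ => ?_))
      simp [ha]
    · rw [if_neg ha]
      refine Finset.sum_nonneg fun p _ => mul_nonneg (h0 p) ?_
      split_ifs <;> norm_num
  have h2 : ∑ p, μ p * I.score η θ T p ≤ W * I.score η θ T b := by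
    calc ∑ p, μ p * I.score η θ T p ≤ ∑ p, μ p * I.score η θ T b :=
          Finset.sum_le_sum fun p _ => mul_le_mul_of_nonneg_left (hb p) (h0 p)
      _ = (∑ p, μ p) * I.score η θ T b := by rw [Finset.sum_mul]
      _ ≤ _ := mul_le_mul_of_nonneg_right hW hb0
  have h3 : I.pot η θ T ≤ 2 * I.k * (W * I.score η θ T b) := by
    refine le_trans ?_ (mul_le_mul_of_nonneg_left (h1.trans h2) (by positivity))
    unfold pot
    simp only [Finset.mul_sum]
    exact Finset.sum_le_sum fun f _ => Finset.sum_le_sum fun y _ => by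
      simpa using deficit_le (I := I) (η := η) (θ := θ) (T := T) (f := f) (y := y)
  have h4 : β * I.pot η θ T ≤ I.score η θ T b := by
    calc β * I.pot η θ T ≤ β * (2 * I.k * (W * I.score η θ T b)) :=
          mul_le_mul_of_nonneg_left h3 hβ0
      _ = β * (2 * I.k * W) * I.score η θ T b := by ring
      _ ≤ 1 * I.score η θ T b := mul_le_mul_of_nonneg_right hβ hb0
      _ = _ := one_mul _
  have := pot_cons_le (p := b) (T := T) hη hθ
  linarith

theorem not_active_greedy (hη : 0 ≤ η) (hθ : 0 ≤ θ) {W β : ℝ} {μ : I.Pt → ℝ}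
    (hμ : I.IsFractionalHitting η θ W μ) (hβ0 : 0 ≤ β) (hβ1 : β ≤ 1)
    (hβ : β * (2 * I.k * W) ≤ 1) {R : ℕ}
    (hR : (2 * I.k * I.numFacilities * I.numClients + 1) * (1 - β) ^ R < 1) :
    ¬ I.Active η θ (I.greedy η θ R) f y := by
  have h : ∀ j, I.pot η θ (I.greedy η θ j) ≤
      (2 * I.k * I.numFacilities * I.numClients + 1) * (1 - β) ^ j := by
    intro j
    induction j with
    | zero => linarith [pot_le_card (I := I) (θ := θ) (η := η) (T := I.greedy η θ 0)]
    | succ j ih =>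
      refine (pot_greedy_succ_le hη hθ hμ hβ0 hβ j).trans ?_
      rw [pow_succ]
      nlinarith
  exact not_active_of_pot_lt ((h R).trans_lt hR)

end Greedy

/-! ### The fractional hitting measure of a solution. -/

section Hitting

variable {I}

/-- There may be fewer than `K` points; then `A` consists of all of them and the last clause is
vacuous. -/
theorem exists_nearest {α : Type*} [Fintype α] (g : α → ℝ) (K : ℕ) :
    ∃ A : Finset α, A.card ≤ K ∧ ∀ y ∉ A, A.card = K ∧ ∀ a ∈ A, g a ≤ g y := by
  classical
  induction K with
  | zero => exact ⟨∅, by simp⟩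
  | succ K ih =>
    obtain ⟨A, hA, h⟩ := ih
    by_cases hu : A = Finset.univ
    · exact ⟨A, by omega, fun y hy => absurd (Finset.mem_univ y) (hu ▸ hy)⟩
    · have hne : (Aᶜ).Nonempty := by
        rwa [Finset.nonempty_iff_ne_empty, Ne, Finset.compl_eq_empty_iff]
      obtain ⟨b, hb, hmin⟩ := Finset.exists_min_image _ g hne
      rw [Finset.mem_compl] at hb
      refine ⟨insert b A, by rw [Finset.card_insert_of_notMem hb]; omega, fun y hy => ?_⟩
      rw [Finset.mem_insert, not_or] at hy
      refine ⟨by rw [Finset.card_insert_of_notMem hb, (h b hb).1], fun a ha => ?_⟩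
      rw [Finset.mem_insert] at ha
      rcases ha with rfl | ha
      · exact hmin y (by simpa using hy.2)
      · exact (h y hy.2).2 a ha

/-- The fractional hitting measure built from a clustering and its centers. -/
theorem exists_fractionalHitting {η θ : ℝ} (hη : 0 < η) (hθ : 0 ≤ θ) (τ : I.Clustering)
    (fs : Fin I.k → Fin I.numFacilities) (hθΨ : θ = 0 → ∑ c, I.d (I.cl c) (fs (τ c)) = 0) :
    ∃ μ, I.IsFractionalHitting η θ
      (2 * I.k ^ 2 + (∑ c, I.d (I.cl c) (fs (τ c))) / (η * θ)) μ := by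
  classical
  set D : Fin I.numClients → ℝ := fun c => I.d (I.cl c) (fs (τ c)) with hD
  have hD0 : ∀ c, 0 ≤ D c := fun c => I.d_nonneg _ _
  choose A hA hA' using fun i : Fin I.k => exists_nearest (fun p : I.Pt => I.d p (fs i)) (2 * I.k)
  -- The normalization gives mass one to clients of total cost `η * θ`. For `θ = 0` division yields
  -- zero, which is harmless because all costs vanish by `hθΨ`.
  set ν : I.Pt → ℝ := Fin.append (fun c => D c / (η * θ)) (fun _ => 0) with hν
  have hν0 : ∀ p, 0 ≤ ν p := by
    intro p
    refine Fin.addCases (fun c => ?_) (fun c => ?_) p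
    · rw [hν, Fin.append_left]
      exact div_nonneg (hD0 c) (by positivity)
    · rw [hν, Fin.append_right]
  have hat0 : ∀ p, (0 : ℝ) ≤ ∑ i : Fin I.k, if p ∈ A i then (1 : ℝ) else 0 := fun p =>
    Finset.sum_nonneg fun i _ => by split_ifs <;> norm_num
  refine ⟨fun p => (∑ i : Fin I.k, if p ∈ A i then 1 else 0) + ν p, fun p => ?_, ?_, ?_⟩
  · exact add_nonneg (hat0 p) (hν0 p)
  · rw [Finset.sum_add_distrib, Finset.sum_comm]
    refine add_le_add ?_ (le_of_eq ?_)
    · calc ∑ i : Fin I.k, ∑ p, (if p ∈ A i then (1 : ℝ) else 0)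
          ≤ ∑ i : Fin I.k, (2 * I.k : ℝ) := by
            refine Finset.sum_le_sum fun i _ => ?_
            rw [Finset.sum_boole, Finset.filter_mem_eq_inter, Finset.univ_inter]
            exact_mod_cast hA i
        _ = _ := by simp; ring
    · rw [Fin.sum_univ_add]
      simp [hν, Finset.sum_div]
  · intro T f y hact
    set r := I.rem T f y with hr
    set ρ := I.d (I.cl y) f + θ / r with hρ
    have hr1 : 1 ≤ r := hact.1
    have hρ0 : 0 ≤ ρ := add_nonneg (I.d_nonneg _ _) (div_nonneg hθ (by linarith))
    have hrad : I.rad η θ T f y = (1 + 2 * η) * ρ := rfl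
    have hyρ : I.d (I.cl y) f ≤ ρ := le_add_of_nonneg_right (div_nonneg hθ (by linarith))
    set U := Finset.univ.filter fun c : Fin I.numClients =>
      I.d (I.cl c) f ≤ I.d (I.cl y) f ∧ ¬ I.cl c ∈ T with hU
    have hrU : r = U.card := by simp [hr, rem, hU]
    have atom : ∀ i, ∀ a ∈ A i, ¬ a ∈ T → I.d a f ≤ I.rad η θ T f y →
        1 ≤ ∑ p, ((∑ i : Fin I.k, if p ∈ A i then 1 else 0) + ν p) *
          if ¬ p ∈ T ∧ I.d p f ≤ I.rad η θ T f y then 1 else 0 := by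
      intro i a ha haT had
      refine le_trans ?_ (Finset.single_le_sum (f := fun p =>
        ((∑ i : Fin I.k, if p ∈ A i then 1 else 0) + ν p) *
          if ¬ p ∈ T ∧ I.d p f ≤ I.rad η θ T f y then (1 : ℝ) else 0)
        (fun p _ => mul_nonneg (add_nonneg (hat0 p) (hν0 p)) (by split_ifs <;> norm_num))
        (Finset.mem_univ a))
      rw [if_pos ⟨haT, had⟩, mul_one]
      refine le_add_of_le_of_nonneg ?_ (hν0 a)
      refine le_trans ?_ (Finset.single_le_sum (f := fun i => if a ∈ A i then (1 : ℝ) else 0)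
        (fun i _ => by split_ifs <;> norm_num) (Finset.mem_univ i))
      simp [ha]
    -- Either an unhit client of the ball is cheap compared with `ρ`, and an atom is found, or all
    -- of them are expensive and carry enough mass through `ν`.
    by_cases hc : ∃ c ∈ U, D c ≤ η * ρ
    · obtain ⟨c, hcU, hcD⟩ := hc
      rw [hU, Finset.mem_filter] at hcU
      have hcf : I.d (I.cl c) f ≤ ρ := hcU.2.1.trans hyρ
      by_cases hcA : I.cl c ∈ A (τ c)
      · refine atom _ _ hcA hcU.2.2 ?_
        rw [hrad]
        nlinarith
      · obtain ⟨hcard, hle⟩ := hA' _ _ hcA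
        have hball : ∀ a ∈ A (τ c), I.d a f ≤ I.rad η θ T f y := by
          intro a ha
          have h1 : I.d a (fs (τ c)) ≤ D c := hle a ha
          have h2 : I.d a f ≤ I.d a (fs (τ c)) + D c + I.d (I.cl c) f := by
            simp only [hD, d]
            have := dist_triangle4 (I.pt a) (I.facility (fs (τ c))) (I.pt (I.cl c)) (I.facility f)
            rwa [dist_comm (I.facility (fs (τ c)))] at this
          rw [hrad]
          nlinarith
        -- If all `2k` points of `A (τ c)` were in `T`, they would be `2k` hits of an active ball.
        by_contra hcon
        have hsub : ∀ a ∈ A (τ c), a ∈ T := by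
          intro a ha
          by_contra haT
          exact hcon (atom _ a ha haT (hball a ha))
        have h3 : (2 * I.k : ℝ) ≤ I.hits η θ T f y := by
          rw [hits, Finset.sum_boole]
          have : A (τ c) ⊆ Finset.univ.filter fun p => p ∈ T ∧ I.d p f ≤ I.rad η θ T f y := by
            intro a ha
            simp [hsub a ha, hball a ha]
          have := Finset.card_le_card this
          rw [hcard] at this
          exact_mod_cast this
        linarith [hact.2]
    · push Not at hc
      have hUne : U.Nonempty := by
        rw [← Finset.card_pos]
        have : (0 : ℝ) < U.card := by rw [← hrU]; linarith
        exact_mod_cast this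
      have hΨ0 : 0 < ∑ c, D c := by
        obtain ⟨c, hcU⟩ := hUne
        refine lt_of_lt_of_le ?_ (Finset.single_le_sum (fun c _ => hD0 c) (Finset.mem_univ c))
        exact lt_of_le_of_lt (by positivity) (hc c hcU)
      have hθ0 : 0 < θ := by
        refine lt_of_le_of_ne hθ fun h => ?_
        exact hΨ0.ne' (hθΨ h.symm)
      -- This is the purpose of the summand `θ / r` in the radius: it forces `r * ρ ≥ θ`.
      have hsum : η * θ ≤ ∑ c ∈ U, D c := by
        calc η * θ ≤ r * (η * ρ) := by
              have : r * ρ = r * I.d (I.cl y) f + θ := by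
                rw [hρ, mul_add, mul_div_cancel₀ _ (by linarith : r ≠ 0)]
              have h5 : 0 ≤ r * I.d (I.cl y) f := mul_nonneg (by linarith) (I.d_nonneg _ _)
              nlinarith
          _ = ∑ c ∈ U, η * ρ := by rw [Finset.sum_const, nsmul_eq_mul, hrU]
          _ ≤ _ := Finset.sum_le_sum fun c h => (hc c h).le
      rw [Fin.sum_univ_add]
      refine le_add_of_le_of_nonneg ?_ ?_
      · calc (1 : ℝ) ≤ (∑ c ∈ U, D c) / (η * θ) := by
              rwa [le_div_iff₀ (by positivity), one_mul]
          _ = ∑ c, if c ∈ U then D c / (η * θ) else 0 := by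
              rw [Finset.sum_div, Finset.sum_ite_mem, Finset.univ_inter]
          _ ≤ _ := by
              refine Finset.sum_le_sum fun c _ => ?_
              split_ifs with h1 h2 h2
              · rw [mul_one]
                refine le_add_of_nonneg_of_le (hat0 _) ?_
                simp [hν]
              · exfalso
                apply h2
                rw [hU, Finset.mem_filter] at h1
                refine ⟨h1.2.2, ?_⟩
                have := h1.2.1.trans hyρ
                rw [hrad]
                nlinarith
              · exact mul_nonneg (add_nonneg (hat0 _) (hν0 _)) zero_le_one
              · simp
      · exact Finset.sum_nonneg fun g _ =>
          mul_nonneg (add_nonneg (hat0 _) (hν0 _)) (by split_ifs <;> norm_num)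

end Hitting

end Instance

namespace Instance

variable {I : Instance.{u}}

/-! ### From the absence of active balls to good centers. -/

section Analysis

variable {η θ : ℝ} {T : List I.Pt}

/-- If no ball is active, then some client of the cluster `C` near the center `f` lies in `T`, or
`2k` points of `T` lie near `f`. -/
theorem exists_cluster_radius (hη : 0 < η) (hη1 : η ≤ 1) (hθ : 0 ≤ θ)
    (hT : ∀ f y, ¬ I.Active η θ T f y) (C : Finset (Fin I.numClients)) (hC : C.Nonempty)
    (f : Fin I.numFacilities) :
    ∃ ρ : ℝ, C.card * ρ ≤ (1 + 2 * η) * ((1 + η) * ∑ c ∈ C, I.d (I.cl c) f + 2 * θ / η) ∧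
      ((∃ c ∈ C, I.cl c ∈ T ∧ I.d (I.cl c) f ≤ ρ) ∨
        2 * I.k ≤ (T.toFinset.filter fun p => I.d p f ≤ ρ).card) := by
  classical
  set A := ∑ c ∈ C, I.d (I.cl c) f with hA
  have hd := fun c : Fin I.numClients => I.d_nonneg (I.cl c) f
  have hA0 : 0 ≤ A := Finset.sum_nonneg fun c _ => hd c
  have hn : (0 : ℝ) < C.card := by exact_mod_cast hC.card_pos
  set n : ℝ := (C.card : ℝ) with hn'
  set a := A / n with ha
  have hna : n * a = A := mul_div_cancel₀ _ hn.ne'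
  have ha0 : 0 ≤ a := div_nonneg hA0 hn.le
  set U := C.filter fun c => I.d (I.cl c) f ≤ (1 + η) * a with hU
  -- Markov's inequality: at most `n / (1 + η)` clients are farther than `(1 + η) * a`, and `η / (1
  -- + η) ≥ η / 2`. If `a = 0`, all clients of `C` sit at `f`.
  have hUn : η * n ≤ 2 * U.card := by
    have hcard : (U.card : ℝ) + ((C.filter fun c => ¬ I.d (I.cl c) f ≤ (1 + η) * a).card : ℝ) = n := by
      rw [hn', hU]
      exact_mod_cast Finset.card_filter_add_card_filter_not _
    set V := C.filter fun c => ¬ I.d (I.cl c) f ≤ (1 + η) * a with hV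
    have hVA : (V.card : ℝ) * ((1 + η) * a) ≤ A := by
      calc (V.card : ℝ) * ((1 + η) * a) = ∑ c ∈ V, (1 + η) * a := by simp
        _ ≤ ∑ c ∈ V, I.d (I.cl c) f := Finset.sum_le_sum fun c hc => by
            rw [hV, Finset.mem_filter] at hc
            exact (not_le.1 hc.2).le
        _ ≤ A := Finset.sum_le_sum_of_subset_of_nonneg (Finset.filter_subset _ _)
            fun c _ _ => hd c
    rcases ha0.eq_or_lt with h0 | h0
    · have hAz : A = 0 := by rw [← hna, ← h0, mul_zero]
      have hVe : V = ∅ := by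
        rw [hV, Finset.filter_eq_empty_iff]
        intro c hc
        rw [not_not, ← h0, mul_zero]
        exact ((Finset.sum_eq_zero_iff_of_nonneg fun c _ => hd c).1 (hA ▸ hAz) c hc).le
      rw [hVe] at hcard
      simp only [Finset.card_empty, Nat.cast_zero, add_zero] at hcard
      rw [hcard]
      nlinarith
    · have h1 : (V.card : ℝ) * (1 + η) ≤ n := by
        rw [← hna, ← mul_assoc] at hVA
        exact le_of_mul_le_mul_right hVA h0
      have h2 : (0 : ℝ) ≤ U.card := Nat.cast_nonneg _
      nlinarith
  have hUpos : (0 : ℝ) < U.card := by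
    have := mul_pos hη hn
    linarith
  have hUne : U.Nonempty := by
    rw [← Finset.card_pos]
    exact_mod_cast hUpos
  -- The enlarged radius for distance at most `(1 + η) * a` and at least `η * n / 2` clients outside
  -- `T`.
  set ρ := (1 + 2 * η) * ((1 + η) * a + 2 * θ / (η * n)) with hρ
  refine ⟨ρ, le_of_eq ?_, ?_⟩
  · rw [hρ, ← hna]
    field_simp
  by_cases hc : ∃ c ∈ U, I.cl c ∈ T
  · obtain ⟨c, hcU, hcT⟩ := hc
    rw [hU, Finset.mem_filter] at hcU
    refine .inl ⟨c, hcU.1, hcT, hcU.2.trans ?_⟩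
    have h1 : 0 ≤ 2 * θ / (η * n) := by positivity
    have h2 : 0 ≤ (1 + η) * a := by positivity
    rw [hρ]
    nlinarith
  · push Not at hc
    right
    -- The ball with the farthest client of `U` on its boundary contains `U`, which is disjoint from
    -- `T`. As it is not active, it has been hit `2k` times.
    obtain ⟨y, hyU, hy⟩ := Finset.exists_max_image U (fun c => I.d (I.cl c) f) hUne
    have hrem : (U.card : ℝ) ≤ I.rem T f y := by
      rw [rem, Finset.sum_boole, Nat.cast_le]
      refine Finset.card_le_card fun c hcU => ?_
      simp [hy c hcU, hc c hcU]
    have hU1 : (1 : ℝ) ≤ U.card := by exact_mod_cast hUne.card_pos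
    have hhits : (2 * I.k : ℝ) < I.hits η θ T f y + 1 := by
      by_contra hcon
      exact hT f y ⟨hU1.trans hrem, not_lt.1 hcon⟩
    have hrad : I.rad η θ T f y ≤ ρ := by
      rw [rad, hρ]
      have h1 : I.d (I.cl y) f ≤ (1 + η) * a := (Finset.mem_filter.1 hyU).2
      have h2 : θ / I.rem T f y ≤ 2 * θ / (η * n) := by
        rw [div_le_div_iff₀ (by linarith) (by positivity)]
        nlinarith
      have h3 : 0 ≤ 1 + 2 * η := by linarith
      gcongr
    rw [hits, Finset.sum_boole] at hhits
    have h4 : 2 * I.k <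
        (Finset.univ.filter fun p => p ∈ T ∧ I.d p f ≤ I.rad η θ T f y).card + 1 := by
      exact_mod_cast hhits
    refine (Nat.lt_succ_iff.1 h4).trans (Finset.card_le_card fun p hp => ?_)
    simp only [Finset.mem_filter, Finset.mem_univ, true_and] at hp
    simp [hp.1, hp.2.trans hrad]

/-- Hall's condition: indices in `J` are served injectively by `h`, and one index outside `J`
already offers `k` elements, as many as there are indices. -/
theorem exists_injective_choice {α : Type*} {k : ℕ} (t : Fin k → Finset α) (J : Set (Fin k))
    (h : Fin k → α) (hJ : ∀ i ∈ J, h i ∈ t i) (hinj : Set.InjOn h J)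
    (hk : ∀ i ∉ J, k ≤ (t i).card) : ∃ F : Fin k ↪ α, ∀ i, F i ∈ t i := by
  classical
  obtain ⟨F, hF, hFt⟩ := (Finset.all_card_le_biUnion_card_iff_exists_injective t).1 (by
    intro s
    by_cases hs : ∀ i ∈ s, i ∈ J
    · rw [← Finset.card_image_of_injOn (hinj.mono hs)]
      refine Finset.card_le_card fun a ha => ?_
      obtain ⟨i, hi, rfl⟩ := Finset.mem_image.1 ha
      exact Finset.mem_biUnion.2 ⟨i, hi, hJ i (hs i hi)⟩
    · push Not at hs
      obtain ⟨i, hi, hiJ⟩ := hs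
      refine (s.card_le_univ.trans_eq (Fintype.card_fin k)).trans ((hk i hiJ).trans ?_)
      exact Finset.card_le_card (Finset.subset_biUnion_of_mem t hi))
  exact ⟨⟨F, hF⟩, hFt⟩

/-- The cost of a clustering when each cluster is served by the center with the same index. -/
noncomputable def serve (I : Instance.{u}) (F : Fin I.k → Fin I.numFacilities)
    (τ : I.Clustering) : ℝ := ∑ c, I.d (I.cl c) (F (τ c))

/-- By the triangle inequality each client of cluster `i` pays at most `q * ρ i` more; `hρ` bounds
this surcharge cluster by cluster. -/
theorem serve_le {τ : I.Clustering} {fs F : Fin I.k → Fin I.numFacilities} {ρ : Fin I.k → ℝ}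
    {r q b : ℝ} (hq : 0 ≤ q)
    (hρ : ∀ i, (Finset.univ.filter fun c => τ c = i).card * ρ i ≤
      r * ((1 + η) * ∑ c with τ c = i, I.d (I.cl c) (fs i) + b))
    (hF : ∀ c, dist (I.facility (F (τ c))) (I.facility (fs (τ c))) ≤ q * ρ (τ c)) :
    I.serve F τ ≤ I.serve fs τ + q * (r * ((1 + η) * I.serve fs τ + I.k * b)) := by
  classical
  have h1 : ∑ c, ρ (τ c) ≤ r * ((1 + η) * I.serve fs τ + I.k * b) := by
    calc ∑ c, ρ (τ c) = ∑ i, ∑ c with τ c = i, ρ (τ c) := (Finset.sum_fiberwise _ _ _).symm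
      _ = ∑ i, (Finset.univ.filter fun c => τ c = i).card * ρ i := by
          refine Finset.sum_congr rfl fun i _ => ?_
          rw [← nsmul_eq_mul, ← Finset.sum_const]
          exact Finset.sum_congr rfl fun c hc => by rw [(Finset.mem_filter.1 hc).2]
      _ ≤ ∑ i, r * ((1 + η) * ∑ c with τ c = i, I.d (I.cl c) (fs i) + b) :=
          Finset.sum_le_sum fun i _ => hρ i
      _ = r * ((1 + η) * (∑ i, ∑ c with τ c = i, I.d (I.cl c) (fs i)) + I.k * b) := by
          rw [← Finset.mul_sum, Finset.sum_add_distrib, ← Finset.mul_sum]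
          simp
      _ = _ := by
          have : I.serve fs τ = ∑ i, ∑ c with τ c = i, I.d (I.cl c) (fs (τ c)) :=
            (Finset.sum_fiberwise _ _ _).symm
          rw [this]
          congr 3
          refine Finset.sum_congr rfl fun i _ => Finset.sum_congr rfl fun c hc => ?_
          rw [(Finset.mem_filter.1 hc).2]
  calc I.serve F τ ≤ ∑ c, (I.d (I.cl c) (fs (τ c)) + q * ρ (τ c)) := by
        refine Finset.sum_le_sum fun c _ => ?_
        have := dist_triangle (I.pt (I.cl c)) (I.facility (fs (τ c))) (I.facility (F (τ c)))
        rw [dist_comm (I.facility (fs (τ c)))] at this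
        exact this.trans (add_le_add le_rfl (hF c))
    _ = I.serve fs τ + q * ∑ c, ρ (τ c) := by rw [Finset.sum_add_distrib, Finset.mul_sum, serve]
    _ ≤ _ := by gcongr

theorem exists_facility (h : I.ClientsSubsetFacilities) (p : I.Pt) :
    ∃ f, I.pt p = I.facility f := by
  refine Fin.addCases (fun c => ?_) (fun f => ⟨f, I.pt_fc f⟩) p
  obtain ⟨f, hf⟩ := h ⟨c, rfl⟩
  exact ⟨f, by rw [hf]; exact I.pt_cl c⟩

theorem k_le_card_cands (hT : T ≠ []) : I.k ≤ (I.cands T).toFinset.card := by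
  classical
  obtain ⟨p, hp⟩ := List.exists_mem_of_ne_nil T hT
  rw [← length_near p, ← List.toFinset_card_of_nodup (nodup_near p)]
  refine Finset.card_le_card fun f hf => ?_
  rw [List.mem_toFinset] at hf ⊢
  exact near_subset_cands hp hf

/-- Every center of a nonempty cluster is replaced by a candidate within `2 * ρ i`, or within `ρ i`
if clients are locations; empty clusters take any candidate. Hall's theorem keeps the replacements
distinct. -/
theorem exists_good_centers {g : ℝ} (hη : 0 < η) (hη1 : η ≤ 1) (hg : 0 ≤ g) (hT : T ≠ [])
    (hact : ∀ f y, ¬ I.Active η (η ^ 2 / I.k * g) T f y) (τ : I.Clustering) (fs : I.CenterSet)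
    (hgΨ : g ≤ I.serve fs τ) :
    (∃ F : I.CenterSet, (∀ i, F i ∈ I.cands T) ∧
      I.serve F τ ≤ (3 + 22 * η) * I.serve fs τ) ∧
    (I.ClientsSubsetFacilities → ∃ F : I.CenterSet, (∀ i, F i ∈ I.cands T) ∧
      I.serve F τ ≤ (2 + 11 * η) * I.serve fs τ) := by
  classical
  have hk : (0 : ℝ) < I.k := by exact_mod_cast I.k_pos
  have hθ : 0 ≤ η ^ 2 / I.k * g := by positivity
  have hrad : ∀ i, ∃ ρ : ℝ, (Finset.univ.filter fun c => τ c = i).card * ρ ≤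
      (1 + 2 * η) * ((1 + η) * ∑ c with τ c = i, I.d (I.cl c) (fs i) +
        2 * (η ^ 2 / I.k * g) / η) ∧
      ((∀ c, τ c ≠ i) ∨ (∃ c, τ c = i ∧ I.cl c ∈ T ∧ I.d (I.cl c) (fs i) ≤ ρ) ∨
        2 * I.k ≤ (T.toFinset.filter fun p => I.d p (fs i) ≤ ρ).card) := by
    intro i
    by_cases hi : ∃ c, τ c = i
    · obtain ⟨c, hc⟩ := hi
      obtain ⟨ρ, h1, h2⟩ := exists_cluster_radius hη hη1 hθ hact
        (Finset.univ.filter fun c => τ c = i) ⟨c, by simpa using hc⟩ (fs i)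
      exact ⟨ρ, h1, .inr (by simpa using h2)⟩
    · push Not at hi
      refine ⟨0, ?_, .inl hi⟩
      rw [mul_zero]
      have := Finset.sum_nonneg (s := Finset.univ.filter fun c => τ c = i)
        fun c _ => I.d_nonneg (I.cl c) (fs i)
      positivity
  choose ρ hρ hcase using hrad
  have hΨ0 : 0 ≤ I.serve fs τ := hg.trans hgΨ
  -- With `θ = η² g / k` the error terms of the `k` clusters add up to `2 * η * g ≤ 2 * η * Ψ`, and
  -- `(1 + 2η)(1 + 3η) ≤ 1 + 11η`.
  have hbound : (1 + 2 * η) * ((1 + η) * I.serve fs τ + I.k * (2 * (η ^ 2 / I.k * g) / η)) ≤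
      (1 + 11 * η) * I.serve fs τ := by
    have : I.k * (2 * (η ^ 2 / I.k * g) / η) = 2 * η * g := by field_simp
    rw [this]
    calc (1 + 2 * η) * ((1 + η) * I.serve fs τ + 2 * η * g)
        ≤ (1 + 2 * η) * ((1 + η) * I.serve fs τ + 2 * η * I.serve fs τ) := by gcongr
      _ = (1 + 5 * η + 6 * (η * η)) * I.serve fs τ := by ring
      _ ≤ _ := by
          refine mul_le_mul_of_nonneg_right ?_ hΨ0
          nlinarith
  have hd0 : ∀ f, dist (I.facility f) (I.facility f) = 0 := fun f => dist_self _
  constructor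
  · set t : Fin I.k → Finset (Fin I.numFacilities) := fun i => (I.cands T).toFinset.filter fun f =>
      ∀ c, τ c = i → dist (I.facility f) (I.facility (fs i)) ≤ 2 * ρ i with ht
    -- A center that is itself admissible is kept. Otherwise it is missing from `I.near p` for some
    -- `p` in `T` within `ρ i`, so the `k` locations in that list are no farther from `p` than `fs
    -- i` is, hence within `2 * ρ i` of `fs i`.
    obtain ⟨F, hF⟩ := exists_injective_choice t {i | fs i ∈ t i} fs (fun i hi => hi)
      fs.injective.injOn (by
        intro i hi
        by_cases hci : ∀ c, τ c ≠ i
        · refine (k_le_card_cands hT).trans (Finset.card_le_card fun f hf => ?_)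
          rw [ht, Finset.mem_filter]
          exact ⟨hf, fun c hc => absurd hc (hci c)⟩
        · have hx : ∃ p ∈ T, I.d p (fs i) ≤ ρ i := by
            rcases hcase i with h | ⟨c, _, h1, h2⟩ | h
            · exact absurd h hci
            · exact ⟨_, h1, h2⟩
            · have : 0 < (T.toFinset.filter fun p => I.d p (fs i) ≤ ρ i).card := by
                have := I.k_pos
                omega
              obtain ⟨p, hp⟩ := Finset.card_pos.1 this
              rw [Finset.mem_filter, List.mem_toFinset] at hp
              exact ⟨p, hp⟩
          obtain ⟨p, hpT, hp⟩ := hx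
          have hp0 := I.d_nonneg p (fs i)
          have hnot : fs i ∉ I.near p := by
            intro hmem
            apply hi
            rw [Set.mem_ofPred_eq, ht, Finset.mem_filter, List.mem_toFinset]
            refine ⟨near_subset_cands hpT hmem, fun c _ => ?_⟩
            rw [hd0]
            linarith
          rw [← length_near p, ← List.toFinset_card_of_nodup (nodup_near p)]
          refine Finset.card_le_card fun f hf => ?_
          rw [List.mem_toFinset] at hf
          rw [ht, Finset.mem_filter, List.mem_toFinset]
          refine ⟨near_subset_cands hpT hf, fun c _ => ?_⟩
          have h1 := le_of_mem_near hnot hf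
          have h2 := dist_triangle_left (I.facility f) (I.facility (fs i)) (I.pt p)
          unfold d at h1 hp
          linarith)
    refine ⟨F, fun i => ?_, ?_⟩
    · have := hF i
      rw [ht, Finset.mem_filter, List.mem_toFinset] at this
      exact this.1
    · refine (serve_le (q := 2) (by norm_num) hρ fun c => ?_).trans ?_
      · have := hF (τ c)
        rw [ht, Finset.mem_filter] at this
        exact this.2 c rfl
      · linarith
  · intro hsub
    choose own hown using exists_facility hsub
    set t : Fin I.k → Finset (Fin I.numFacilities) := fun i => (I.cands T).toFinset.filter fun f =>
      ∀ c, τ c = i → dist (I.facility f) (I.facility (fs i)) ≤ ρ i with ht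
    have hgood : ∀ i, ∀ p ∈ T, I.d p (fs i) ≤ ρ i → own p ∈ t i := by
      intro i p hpT hp
      rw [ht, Finset.mem_filter, List.mem_toFinset]
      refine ⟨near_subset_cands hpT (mem_near_of_pt_eq (hown p)), fun c _ => ?_⟩
      rwa [← hown p]
    set J : Set (Fin I.k) :=
      {i | ∃ c, τ c = i ∧ I.cl c ∈ T ∧ I.d (I.cl c) (fs i) ≤ ρ i} with hJ
    set h : Fin I.k → Fin I.numFacilities := fun i =>
      if hi : i ∈ J then own (I.cl hi.choose) else fs i with hh
    -- A client of `T` in cluster `i` near the center serves as replacement; a client lies in one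
    -- cluster only, which gives injectivity.
    obtain ⟨F, hF⟩ := exists_injective_choice t J h (by
        intro i hi
        simp only [hh, dif_pos hi]
        exact hgood i _ hi.choose_spec.2.1 hi.choose_spec.2.2) (by
        intro i hi j hj hij
        simp only [hh, dif_pos hi, dif_pos hj] at hij
        have h1 := hown (I.cl hi.choose)
        rw [hij, ← hown, pt_cl, pt_cl] at h1
        rw [← hi.choose_spec.1, ← hj.choose_spec.1, I.client.injective h1]) (by
        intro i hi
        rcases hcase i with hci | hci | hci
        · refine (k_le_card_cands hT).trans (Finset.card_le_card fun f hf => ?_)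
          rw [ht, Finset.mem_filter]
          exact ⟨hf, fun c hc => absurd hc (hci c)⟩
        · exact absurd hci hi
        · set S := T.toFinset.filter fun p => I.d p (fs i) ≤ ρ i with hS
          -- A location occurs at most twice among the points, as a client and as a facility, so
          -- `2k` points of `T` yield `k` distinct locations. Hence the threshold `2k` for hits.
          have hfib : ∀ b ∈ S.image own, (S.filter fun p => own p = b).card ≤ 2 := by
            intro b _
            have hcl : ∀ p, own p = b →
                p ∈ (Finset.univ.filter fun c => I.client c = I.facility b).image I.cl ∪ {I.fc b} := by
              intro p
              refine Fin.addCases (fun c => ?_) (fun f => ?_) p <;> intro hp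
              · have := hown (I.cl c)
                rw [pt_cl, hp] at this
                simp only [Finset.mem_union, Finset.mem_image, Finset.mem_filter]
                exact .inl ⟨c, ⟨Finset.mem_univ _, this⟩, rfl⟩
              · have := hown (I.fc f)
                rw [pt_fc, hp] at this
                rw [I.facility.injective this]
                simp
            calc (S.filter fun p => own p = b).card
                ≤ ((Finset.univ.filter fun c => I.client c = I.facility b).image I.cl ∪
                    {I.fc b}).card :=
                  Finset.card_le_card fun p hp => hcl p (Finset.mem_filter.1 hp).2
              _ ≤ 1 + 1 := by
                  refine (Finset.card_union_le _ _).trans (add_le_add ?_ (by simp))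
                  refine Finset.card_image_le.trans (Finset.card_le_one.2 fun c hc c' hc' => ?_)
                  rw [Finset.mem_filter] at hc hc'
                  exact I.client.injective (hc.2.trans hc'.2.symm)
          have h2 := Finset.card_le_mul_card_image S 2 hfib
          have h3 : (S.image own).card ≤ (t i).card := by
            refine Finset.card_le_card fun f hf => ?_
            obtain ⟨p, hp, rfl⟩ := Finset.mem_image.1 hf
            rw [hS, Finset.mem_filter, List.mem_toFinset] at hp
            exact hgood i p hp.1 hp.2
          omega)
    refine ⟨F, fun i => ?_, ?_⟩
    · have := hF i
      rw [ht, Finset.mem_filter, List.mem_toFinset] at this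
      exact this.1
    · refine (serve_le (q := 1) (by norm_num) hρ fun c => ?_).trans ?_
      · have := hF (τ c)
        rw [ht, Finset.mem_filter] at this
        rw [one_mul]
        exact this.2 c rfl
      · linarith

end Analysis

end Instance

/-! ## The program -/

/-- An index as a real number. -/
noncomputable def Val.ofFin {n : ℕ} (j : Fin n) : Val := .real ((j : ℕ) : ℝ)

section Programs

variable {ι : Type*} {m : ι → ℕ} {x : ι → Val}

theorem Computes.head {β : ι → Type} {eb : ∀ i, β i → Val} {l : ∀ i, List (β i)}
    (hl : ComputesList m x eb l) (h : ∀ i, l i ≠ []) :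
    Computes m x fun i => eb i ((l i).head (h i)) := by
  refine Computes.fst (z := fun i => Val.ofListMap (eb i) (l i).tail)
    (hl.1.congr fun i => ?_)
  conv_lhs => rw [← List.cons_head_tail (h i)]
  rfl

/-- The list is built from its end: after `t` rounds it holds the last `t` indices, with `n i - t`
as counter. -/
theorem ComputesList.finRange {n : ι → ℕ} (hn : Computes m x fun i => .real (n i))
    (hb : PolyBd m n) :
    ComputesList m x (fun _ => Val.ofFin) fun i => List.finRange (n i) := by
  refine ⟨?_, by simpa using hb⟩
  let e : ℕ → Val := fun j => .real j
  let s : ι → ℕ → Val := fun i t =>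
    .pair (.real ((n i : ℝ) - t)) (Val.ofListMap e (List.range' (n i - t) t))
  have h0 : Computes m x fun i => s i 0 := by
    refine (hn.pair Computes.nil).congr fun i => ?_
    simp [s, Val.ofListMap, Val.ofList]
  have hloop : Computes m (fun i => s i 0) fun i => s i (n i) := by
    refine Computes.loop (b := fun i t => .ofProp ((1 : ℝ) ≤ (n i : ℝ) - t)) hb ?_ ?_ ?_ ?_
    · exact Computes.one.le Computes.id.fst
    · intro i j hj
      rw [Val.ofProp_ne_nil, le_sub_iff_add_le]
      exact_mod_cast (by omega : 1 + j ≤ n i)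
    · intro i
      rw [Val.ofProp_false]
      simp
    · have hid := Computes.id (m := fun q : Σ i, Fin (n i) => m q.1) (x := fun q => s q.1 q.2)
      have hj := hid.fst.sub Computes.one
      refine (hj.pair (hj.pair hid.snd)).congr fun q => ?_
      have h1 : n q.1 - q.2 = n q.1 - (q.2 + 1) + 1 := by have := q.2.2; omega
      have h2 : ((n q.1 : ℝ) - (q.2 : ℕ) - 1) = ((n q.1 - (q.2 + 1) : ℕ) : ℝ) := by
        rw [Nat.cast_sub (by have := q.2.2; omega)]
        push_cast
        ring
      simp only [s]
      rw [List.range'_succ, ← h1]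
      congr 1
      · congr 1
        push_cast
        ring
      · rw [h2]
        rfl
  refine ((h0.comp hloop).snd).congr fun i => ?_
  rw [Nat.sub_self, ← List.range_eq_range', ← List.map_coe_finRange_eq_range]
  simp only [Val.ofListMap, List.map_map]
  rfl

theorem Computes.nth {n : ι → ℕ} {f : ∀ i, Fin (n i) → Val} {j : ∀ i, Fin (n i)}
    (hb : PolyBd m n) (hf : Computes m x fun i => Val.ofSeq (f i))
    (hj : Computes m x fun i => Val.ofFin (j i)) : Computes m x fun i => f i (j i) := by
  let s : ι → ℕ → Val := fun i t =>
    .pair (.real (((j i : ℕ) : ℝ) - t)) (Val.ofList ((List.ofFn (f i)).drop t))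
  have h0 : Computes m x fun i => s i 0 := by
    refine (hj.pair hf).congr fun i => ?_
    simp [s, Val.ofFin, Val.ofSeq]
  have hdrop : ∀ i t, (ht : t < n i) → Val.ofList ((List.ofFn (f i)).drop t) =
      .pair (f i ⟨t, ht⟩) (Val.ofList ((List.ofFn (f i)).drop (t + 1))) := by
    intro i t ht
    rw [List.drop_eq_getElem_cons (by simpa using ht)]
    simp [Val.ofList]
  have hloop : Computes m (fun i => s i 0) fun i => s i (j i) := by
    refine Computes.loop (b := fun i t => .ofProp ((1 : ℝ) ≤ ((j i : ℕ) : ℝ) - t))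
      (hb.mono fun i => (j i).2.le) ?_ ?_ ?_ ?_
    · exact Computes.one.le Computes.id.fst
    · intro i t ht
      rw [Val.ofProp_ne_nil, le_sub_iff_add_le]
      exact_mod_cast (by omega : 1 + t ≤ j i)
    · intro i
      rw [Val.ofProp_false]
      simp
    · have hid := Computes.id (m := fun q : Σ i, Fin (j i) => m q.1) (x := fun q => s q.1 q.2)
      have hsnd : Computes (fun q : Σ i, Fin (j i) => m q.1) (fun q => s q.1 q.2) fun q =>
          .pair (f q.1 ⟨q.2, q.2.2.trans (j q.1).2⟩)
            (Val.ofList ((List.ofFn (f q.1)).drop (q.2 + 1))) :=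
        hid.snd.congr fun q => hdrop _ _ _
      refine ((hid.fst.sub Computes.one).pair hsnd.snd).congr fun q => ?_
      simp only [s]
      congr 2
      push_cast
      ring
  have hres : Computes m x fun i => .pair (f i (j i))
      (Val.ofList ((List.ofFn (f i)).drop (j i + 1))) :=
    ((h0.comp hloop).snd).congr fun i => hdrop _ _ (j i).2
  exact hres.fst

theorem Computes.sum_fin {n : ι → ℕ} {g : ∀ i, Fin (n i) → ℝ}
    (hn : Computes m x fun i => .real (n i)) (hb : PolyBd m n)
    (hg : Computes (fun q : Σ i, Fin (n i) => m q.1) (fun q => .pair (.ofFin q.2) (x q.1))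
      fun q => .real (g q.1 q.2)) :
    Computes m x fun i => .real (∑ j, g i j) :=
  (Computes.sum_list (ComputesList.finRange hn hb) hg).congr fun i => by
    rw [Fin.sum_univ_def]

theorem Computes.count_fin {n : ι → ℕ} {p : ∀ i, Fin (n i) → Prop} [∀ i, DecidablePred (p i)]
    (hn : Computes m x fun i => .real (n i)) (hb : PolyBd m n)
    (hp : Computes (fun q : Σ i, Fin (n i) => m q.1) (fun q => .pair (.ofFin q.2) (x q.1))
      fun q => .ofProp (p q.1 q.2)) :
    Computes m x fun i => .real (∑ j, if p i j then (1 : ℝ) else 0) :=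
  Computes.sum_fin hn hb (Computes.ite_apply (e := fun _ => Val.real) hp Computes.one
    ((Computes.natCast 0).congr fun _ => by simp))

theorem Computes.mem {n : ι → ℕ} {a : ∀ i, Fin (n i)} {l : ∀ i, List (Fin (n i))}
    (ha : Computes m x fun i => .ofFin (a i)) (hl : ComputesList m x (fun _ => Val.ofFin) l) :
    Computes m x fun i => .ofProp (a i ∈ l i) := by
  refine (Computes.foldl (β := fun i => Fin (n i)) (eb := fun _ => Val.ofFin)
    (σ := fun _ => Prop) (es := fun _ => Val.ofProp)
    (f := fun i s b => s ∨ (a i : ℕ) = b) (s := fun _ => False) hl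
    (Computes.nil.congr fun _ => (Val.ofProp_false not_false).symm) ?_).congr fun i => ?_
  · refine Computes.or Computes.id.fst (Computes.eq_nat ?_ Computes.id.snd.fst)
    exact Computes.id.snd.snd.comp (ha.reindex fun q : Σ i, Prop × Fin (n i) => q.1)
  · congr 1
    have : ∀ (l : List (Fin (n i))) (s : Prop),
        l.foldl (fun (s : Prop) (b : Fin (n i)) => s ∨ (a i : ℕ) = b) s = (s ∨ a i ∈ l) := by
      intro l
      induction l with
      | nil => simp
      | cons b l ih =>
        intro s
        simp only [List.foldl_cons, ih, List.mem_cons, Fin.ext_iff, or_assoc]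
    rw [this]
    simp

/-- The numbers and distances of an instance are available in the environment `x`. -/
structure ComputesData (m : ι → ℕ) (x : ι → Val) (D : ι → Instance.{u}) : Prop where
  numClients : Computes m x fun i => .real (D i).numClients
  numFacilities : Computes m x fun i => .real (D i).numFacilities
  k : Computes m x fun i => .real (D i).k
  dist : Computes m x fun i => Val.ofMatrix (D i).d
  numClients_bd : PolyBd m fun i => (D i).numClients
  numFacilities_bd : PolyBd m fun i => (D i).numFacilities

namespace ComputesData

variable {D : ι → Instance.{u}}

theorem weaken {κ : Type*} (h : ComputesData m x D) (π : κ → ι) (w : κ → Val) :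
    ComputesData (fun q => m (π q)) (fun q => .pair (w q) (x (π q))) fun q => D (π q) :=
  ⟨h.1.weaken π w, h.2.weaken π w, h.3.weaken π w, h.4.weaken π w, h.5.reindex π, h.6.reindex π⟩

theorem numPts (h : ComputesData m x D) :
    Computes m x fun i => .real ((D i).numClients + (D i).numFacilities : ℕ) :=
  (h.numClients.add h.numFacilities).congr fun i => by push_cast; rfl

theorem numPts_bd (h : ComputesData m x D) :
    PolyBd m fun i => (D i).numClients + (D i).numFacilities :=
  h.numClients_bd.add h.numFacilities_bd

theorem k_bd (h : ComputesData m x D) : PolyBd m fun i => (D i).k :=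
  h.numFacilities_bd.mono fun i => (D i).k_le

variable (h : ComputesData m x D)
include h

theorem d {p : ∀ i, (D i).Pt} {f : ∀ i, Fin (D i).numFacilities}
    (hp : Computes m x fun i => .ofFin (p i)) (hf : Computes m x fun i => .ofFin (f i)) :
    Computes m x fun i => .real ((D i).d (p i) (f i)) :=
  Computes.nth h.numFacilities_bd (Computes.nth h.numPts_bd h.dist hp) hf

variable {η θ : ι → ℝ} {T : ∀ i, List (D i).Pt} {p : ∀ i, (D i).Pt}
  {f : ∀ i, Fin (D i).numFacilities} {y : ∀ i, Fin (D i).numClients}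

theorem rem (hT : ComputesList m x (fun _ => Val.ofFin) T)
    (hf : Computes m x fun i => .ofFin (f i)) (hy : Computes m x fun i => .ofFin (y i)) :
    Computes m x fun i => .real ((D i).rem (T i) (f i) (y i)) := by
  classical
  unfold Instance.rem
  refine Computes.count_fin h.numClients h.numClients_bd (Computes.and ?_ (Computes.not ?_))
  · exact ((h.weaken _ _).d (p := fun q : Σ i, Fin (D i).numClients => (D q.1).cl q.2) Computes.var (hf.weaken _ _)).le
      ((h.d (p := fun i => (D i).cl (y i)) hy hf).weaken _ _)
  · exact Computes.mem (a := fun q : Σ i, Fin (D i).numClients => (D q.1).cl q.2) Computes.var (hT.weaken _ _)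

theorem rad (hη : Computes m x fun i => .real (η i)) (hθ : Computes m x fun i => .real (θ i))
    (hT : ComputesList m x (fun _ => Val.ofFin) T)
    (hf : Computes m x fun i => .ofFin (f i)) (hy : Computes m x fun i => .ofFin (y i)) :
    Computes m x fun i => .real ((D i).rad (η i) (θ i) (T i) (f i) (y i)) := by
  refine (Computes.one.add (((Computes.natCast 2).congr fun _ => by rfl).mul hη)).mul
    ((h.d (p := fun i => (D i).cl (y i)) hy hf).add (hθ.div (h.rem hT hf hy)))

theorem hits (hη : Computes m x fun i => .real (η i)) (hθ : Computes m x fun i => .real (θ i))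
    (hT : ComputesList m x (fun _ => Val.ofFin) T)
    (hf : Computes m x fun i => .ofFin (f i)) (hy : Computes m x fun i => .ofFin (y i)) :
    Computes m x fun i => .real ((D i).hits (η i) (θ i) (T i) (f i) (y i)) := by
  classical
  unfold Instance.hits
  refine Computes.count_fin h.numPts h.numPts_bd (Computes.and ?_ (Computes.le ?_ ?_))
  · exact Computes.mem Computes.var (hT.weaken _ _)
  · exact (h.weaken _ _).d Computes.var (hf.weaken _ _)
  · exact (h.rad hη hθ hT hf hy).weaken _ _

theorem active (hη : Computes m x fun i => .real (η i)) (hθ : Computes m x fun i => .real (θ i))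
    (hT : ComputesList m x (fun _ => Val.ofFin) T)
    (hf : Computes m x fun i => .ofFin (f i)) (hy : Computes m x fun i => .ofFin (y i)) :
    Computes m x fun i => .ofProp ((D i).Active (η i) (θ i) (T i) (f i) (y i)) :=
  (Computes.one.le (h.rem hT hf hy)).and (((h.hits hη hθ hT hf hy).add Computes.one).le
    ((Computes.natCast 2).mul h.k))

theorem score (hη : Computes m x fun i => .real (η i)) (hθ : Computes m x fun i => .real (θ i))
    (hT : ComputesList m x (fun _ => Val.ofFin) T)
    (hp : Computes m x fun i => .ofFin (p i)) :
    Computes m x fun i => .real ((D i).score (η i) (θ i) (T i) (p i)) := by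
  classical
  unfold Instance.score
  refine Computes.sum_fin h.numFacilities h.numFacilities_bd ?_
  have h1 := h.weaken (Sigma.fst : (Σ i, Fin (D i).numFacilities) → ι) fun q => .ofFin q.2
  have hη1 := hη.weaken (Sigma.fst : (Σ i, Fin (D i).numFacilities) → ι) fun q => .ofFin q.2
  have hθ1 := hθ.weaken (Sigma.fst : (Σ i, Fin (D i).numFacilities) → ι) fun q => .ofFin q.2
  have hT1 := hT.weaken (Sigma.fst : (Σ i, Fin (D i).numFacilities) → ι) fun q => .ofFin q.2
  have hp1 := hp.weaken (Sigma.fst : (Σ i, Fin (D i).numFacilities) → ι) fun q => .ofFin q.2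
  have hf1 := Computes.var (m := fun q : Σ i, Fin (D i).numFacilities => m q.1)
    (w := fun q => .ofFin q.2) (x := fun q => x q.1)
  refine Computes.count_fin h1.numClients h1.numClients_bd
    (Computes.and ?_ (Computes.and (Computes.not ?_) (Computes.le ?_ ?_)))
  · exact (h1.weaken _ _).active (hη1.weaken _ _) (hθ1.weaken _ _) (hT1.weaken _ _)
      (hf1.weaken _ _) Computes.var
  · exact (Computes.mem hp1 hT1).weaken _ _
  · exact (h1.d hp1 hf1).weaken _ _
  · exact (h1.weaken _ _).rad (hη1.weaken _ _) (hθ1.weaken _ _) (hT1.weaken _ _)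
      (hf1.weaken _ _) Computes.var

theorem fac0 : Computes m x fun i => .ofFin ((D i).fc (D i).fac0) :=
  h.numClients.congr fun i => by simp [Val.ofFin, Instance.fac0]

/-- The program never computes `R`: it multiplies `u` by `1 - β` in each round and stops when the
product falls below one, which `hlt` and `hend` place after exactly `R i` rounds. No logarithm is
evaluated. -/
theorem greedy {u β : ι → ℝ} {R : ι → ℕ} (hη : Computes m x fun i => .real (η i))
    (hθ : Computes m x fun i => .real (θ i)) (hu : Computes m x fun i => .real (u i))
    (hβ : Computes m x fun i => .real (β i)) (hR : PolyBd m R)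
    (hlt : ∀ i, ∀ j < R i, 1 ≤ u i * (1 - β i) ^ j) (hend : ∀ i, u i * (1 - β i) ^ R i < 1) :
    ComputesList m x (fun _ => Val.ofFin) fun i => (D i).greedy (η i) (θ i) (R i) := by
  have hlen : ∀ i j, ((D i).greedy (η i) (θ i) j).length = j + 1 := by
    intro i j
    induction j with
    | zero => rfl
    | succ j ih => rw [Instance.greedy, List.length_cons, ih]
  refine ⟨?_, (hR.add (.const 1)).mono fun i => (hlen _ _).le⟩
  let w : ι → ℕ → Val := fun i j =>
    .pair (.real (u i * (1 - β i) ^ j)) (Val.ofListMap Val.ofFin ((D i).greedy (η i) (θ i) j))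
  let s : ι → ℕ → Val := fun i j => .pair (w i j) (x i)
  have h0 : Computes m x fun i => s i 0 := by
    refine ((hu.pair (h.fac0.pair Computes.nil)).pair Computes.id).congr fun i => ?_
    simp [s, w, Instance.greedy, Val.ofListMap, Val.ofList]
  have hloop : Computes m (fun i => s i 0) fun i => s i (R i) := by
    refine Computes.loop (b := fun i j => .ofProp (1 ≤ u i * (1 - β i) ^ j)) hR ?_ ?_ ?_ ?_
    · exact Computes.one.le Computes.id.fst.fst
    · exact fun i j hj => Val.ofProp_ne_nil.2 (hlt i j hj)
    · exact fun i => Val.ofProp_false (not_le.2 (hend i))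
    · have hid := Computes.id (m := fun q : Σ i, Fin (R i) => m q.1) (x := fun q => s q.1 q.2)
      have hT : ComputesList (fun q : Σ i, Fin (R i) => m q.1) (fun q => s q.1 q.2)
          (fun q => Val.ofFin) fun q => (D q.1).greedy (η q.1) (θ q.1) q.2 := by
        refine ⟨hid.fst.snd, ((hR.reindex Sigma.fst).add (.const 1)).mono fun q => ?_⟩
        rw [hlen]
        have := q.2.2
        omega
      have h1 : ComputesData (fun q : Σ i, Fin (R i) => m q.1) (fun q => s q.1 q.2)
        fun q => D q.1 := h.weaken Sigma.fst fun q : Σ i, Fin (R i) => w q.1 q.2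
      have hη1 := hη.weaken Sigma.fst fun q : Σ i, Fin (R i) => w q.1 q.2
      have hθ1 := hθ.weaken Sigma.fst fun q : Σ i, Fin (R i) => w q.1 q.2
      have hβ1 := hβ.weaken Sigma.fst fun q : Σ i, Fin (R i) => w q.1 q.2
      have hpick : Computes (fun q : Σ i, Fin (R i) => m q.1) (fun q => s q.1 q.2) fun q =>
          Val.ofFin (pick ((D q.1).score (η q.1) (θ q.1) ((D q.1).greedy (η q.1) (θ q.1) q.2))
            ((D q.1).fc (D q.1).fac0) (List.finRange _)) := by
        refine Computes.pick (ComputesList.finRange h1.numPts h1.numPts_bd) h1.fac0 ?_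
        exact (h1.weaken _ _).score (hη1.weaken _ _) (hθ1.weaken _ _) (hT.weaken _ _)
          Computes.var
      refine (((hid.fst.fst.mul (Computes.one.sub hβ1)).pair (hpick.pair hid.fst.snd)).pair
        hid.snd).congr fun q => ?_
      simp only [s, w]
      rw [pow_succ, mul_assoc]
      rfl
  exact (h0.comp hloop).fst.snd

theorem near (hp : Computes m x fun i => .ofFin (p i)) :
    ComputesList m x (fun _ => Val.ofFin) fun i => (D i).near (p i) := by
  classical
  unfold Instance.near
  refine ComputesList.filter (ComputesList.finRange h.numFacilities h.numFacilities_bd)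
    (Computes.le (Computes.add ?_ Computes.one) (h.k.weaken _ _))
  unfold Instance.rank
  have h1 := h.weaken (Sigma.fst : (Σ i, Fin (D i).numFacilities) → ι) fun q => .ofFin q.2
  have hp1 := hp.weaken (Sigma.fst : (Σ i, Fin (D i).numFacilities) → ι) fun q => .ofFin q.2
  have hf1 := Computes.var (m := fun q : Σ i, Fin (D i).numFacilities => m q.1)
    (w := fun q => .ofFin q.2) (x := fun q => x q.1)
  refine Computes.count_fin h1.numFacilities h1.numFacilities_bd ?_
  have hdf := (h1.d hp1 hf1).weaken
    (Sigma.fst : (Σ q : Σ i, Fin (D i).numFacilities, Fin (D q.1).numFacilities) → _)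
    fun q => .ofFin q.2
  have hdg := (h1.weaken
    (Sigma.fst : (Σ q : Σ i, Fin (D i).numFacilities, Fin (D q.1).numFacilities) → _)
    fun q => .ofFin q.2).d (hp1.weaken _ _) Computes.var
  -- Strict inequalities are negated reversed ones, `≤` being the only comparison of the machine.
  refine ((hdf.le hdg).not.or ((hdg.le hdf).and
    (Computes.le
      (a := fun q : Σ q : Σ i, Fin (D i).numFacilities, Fin (D q.1).numFacilities => ((q.1.2 : ℕ) : ℝ)) (b := fun q => ((q.2 : ℕ) : ℝ)) (hf1.weaken _ _) Computes.var).not)).congr fun q => ?_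
  congr 1
  simp only [Instance.Before, not_le, Nat.cast_lt, Fin.lt_def]

theorem cands (hT : ComputesList m x (fun _ => Val.ofFin) T) :
    ComputesList m x (fun _ => Val.ofFin) fun i => (D i).cands (T i) :=
  hT.flatMap ((h.weaken _ _).near Computes.var)

end ComputesData

end Programs

/-! ## Enumeration of center sets and the complete program -/

/-- All sequences of `j` distinct members of the list `l`. -/
noncomputable def tuples {n : ℕ} (l : List (Fin n)) : (j : ℕ) → List (Fin j ↪ Fin n)
  | 0 => [⟨Fin.elim0, fun a => a.elim0⟩]
  | j + 1 => l.flatMap fun a => (tuples l j).flatMap fun t => by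
      classical exact if h : a ∈ Set.range t then [] else [Fin.Embedding.cons t h]

theorem mem_tuples {n : ℕ} {l : List (Fin n)} {j : ℕ} {t : Fin j ↪ Fin n} (h : ∀ i, t i ∈ l) :
    t ∈ tuples l j := by
  classical
  induction j with
  | zero =>
    rw [tuples, List.mem_singleton]
    ext i
    exact i.elim0
  | succ j ih =>
    rw [tuples, List.mem_flatMap]
    refine ⟨t 0, h 0, List.mem_flatMap.2 ⟨Fin.Embedding.tail t, ih fun i => h _, ?_⟩⟩
    have hn : t 0 ∉ Set.range (Fin.Embedding.tail t) := by
      rintro ⟨i, hi⟩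
      exact Fin.succ_ne_zero i (t.injective hi)
    rw [dif_neg hn, List.mem_singleton]
    ext i
    refine Fin.cases ?_ (fun i => ?_) i <;> simp [Fin.tail]

theorem length_tuples_le {n : ℕ} (l : List (Fin n)) (j : ℕ) :
    (tuples l j).length ≤ l.length ^ j := by
  classical
  induction j with
  | zero => simp [tuples]
  | succ j ih =>
    rw [tuples, List.length_flatMap, pow_succ']
    refine (List.sum_le_card_nsmul _ (l.length ^ j) ?_).trans (by simp)
    intro r hr
    obtain ⟨a, _, rfl⟩ := List.mem_map.1 hr
    refine le_trans ?_ ih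
    rw [List.length_flatMap]
    refine (List.sum_le_card_nsmul _ 1 ?_).trans (by simp)
    intro r hr
    obtain ⟨t, _, rfl⟩ := List.mem_map.1 hr
    split_ifs <;> simp

/-- The encoding of a sequence of distinct indices. -/
noncomputable def Val.ofEmb {j n : ℕ} (t : Fin j ↪ Fin n) : Val := .ofSeq fun i => .ofFin (t i)

section Programs

variable {ι : Type*} {m : ι → ℕ} {x : ι → Val}

theorem ComputesList.tuples {n k : ι → ℕ} {l : ∀ i, List (Fin (n i))}
    (hk : Computes m x fun i => .real (k i)) (hkb : PolyBd m k)
    (hl : ComputesList m x (fun _ => Val.ofFin) l)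
    (hb : PolyBd m fun i => ((l i).length + 1) ^ k i) :
    ComputesList m x (fun _ => Val.ofEmb) fun i => KMedian.tuples (l i) (k i) := by
  classical
  -- The added one makes the powers monotone in the exponent even for an empty list, so one bound
  -- covers all intermediate lists.
  have hlen : ∀ i, ∀ j ≤ k i, (KMedian.tuples (l i) j).length ≤ ((l i).length + 1) ^ k i :=
    fun i j hj => (length_tuples_le _ _).trans
      ((Nat.pow_le_pow_left (Nat.le_succ _) j).trans (Nat.pow_le_pow_right (by omega) hj))
  refine ⟨?_, hb.mono fun i => hlen i _ le_rfl⟩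
  let w : ι → ℕ → Val := fun i j =>
    .pair (.real ((k i : ℝ) - j)) (Val.ofListMap Val.ofEmb (KMedian.tuples (l i) j))
  let s : ι → ℕ → Val := fun i j => .pair (w i j) (x i)
  have h0 : Computes m x fun i => s i 0 := by
    refine ((hk.pair (Computes.nil.pair Computes.nil)).pair Computes.id).congr fun i => ?_
    simp [s, w, KMedian.tuples, Val.ofListMap, Val.ofList, Val.ofEmb, Val.ofSeq]
  have hloop : Computes m (fun i => s i 0) fun i => s i (k i) := by
    refine Computes.loop (b := fun i j => .ofProp ((1 : ℝ) ≤ (k i : ℝ) - j)) hkb ?_ ?_ ?_ ?_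
    · exact Computes.one.le Computes.id.fst.fst
    · intro i j hj
      rw [Val.ofProp_ne_nil, le_sub_iff_add_le]
      exact_mod_cast (by omega : 1 + j ≤ k i)
    · intro i
      rw [Val.ofProp_false]
      simp
    · have hid := Computes.id (m := fun q : Σ i, Fin (k i) => m q.1) (x := fun q => s q.1 q.2)
      have hS : ComputesList (fun q : Σ i, Fin (k i) => m q.1) (fun q => s q.1 q.2)
          (fun q => Val.ofEmb) fun q => KMedian.tuples (l q.1) q.2 :=
        ⟨hid.fst.snd, (hb.reindex Sigma.fst).mono fun q => hlen q.1 q.2 q.2.2.le⟩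
      have hl1 : ComputesList (fun q : Σ i, Fin (k i) => m q.1) (fun q => s q.1 q.2)
          (fun q => Val.ofFin) fun q => l q.1 :=
        hl.weaken Sigma.fst fun q : Σ i, Fin (k i) => w q.1 q.2
      have hnext : ComputesList (fun q : Σ i, Fin (k i) => m q.1) (fun q => s q.1 q.2)
          (fun q => Val.ofEmb) fun q => KMedian.tuples (l q.1) (q.2 + 1) := by
        simp only [KMedian.tuples]
        refine hl1.flatMap (ComputesList.flatMap (hS.weaken _ _) ?_)
        have ht := Computes.var
          (m := fun q : Σ q : Σ q : Σ i, Fin (k i), Fin (n q.1), Fin q.1.2 ↪ Fin (n q.1.1) =>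
            m q.1.1.1) (w := fun q => Val.ofEmb q.2)
          (x := fun q => .pair (.ofFin q.1.2) (s q.1.1.1 q.1.1.2))
        have ha := (Computes.var (m := fun q : Σ q : Σ i, Fin (k i), Fin (n q.1) => m q.1.1)
          (w := fun q => .ofFin q.2) (x := fun q => s q.1.1 q.1.2)).weaken
          (Sigma.fst : (Σ q : Σ q : Σ i, Fin (k i), Fin (n q.1), Fin q.1.2 ↪ Fin (n q.1.1)) → _)
          fun q => Val.ofEmb q.2
        have hkb1 := hkb.reindex
          fun q : Σ q : Σ q : Σ i, Fin (k i), Fin (n q.1), Fin q.1.2 ↪ Fin (n q.1.1) => q.1.1.1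
        have hmem := Computes.mem (l := fun q => List.ofFn q.2) ha
          ⟨ht.congr fun q => by simp [Val.ofEmb, Val.ofSeq, Val.ofListMap, List.map_ofFn,
            Function.comp_def], hkb1.mono fun q => by
              rw [List.length_ofFn]; exact q.1.1.2.2.le⟩
        refine ⟨(hmem.ite Computes.nil ((ha.pair ht).pair Computes.nil)).congr fun q => ?_,
          (PolyBd.const 1).mono fun q => ?_⟩
        · by_cases h : q.1.2 ∈ Set.range q.2
          · simp only [List.mem_ofFn', h, if_true, dite_true]
            rfl
          · simp [List.mem_ofFn', h, Val.ofListMap, Val.ofList, Val.ofEmb, Val.ofSeq, List.ofFn_succ]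
        · dsimp only
          split_ifs <;> simp
      refine (((hid.fst.fst.sub Computes.one).pair hnext.1).pair hid.snd).congr fun q => ?_
      simp only [s, w]
      congr 3
      push_cast
      ring
  exact (h0.comp hloop).fst.snd

end Programs

/-! ### Guesses, candidate solutions and the choice of the best. -/

namespace Instance

variable (I : Instance.{u})

/-- Guesses for the optimal value. -/
noncomputable def guesses : List ℝ :=
  0 :: (List.finRange I.numClients).flatMap fun y => (List.finRange I.numFacilities).flatMap
    fun f => (List.finRange I.numClients).map fun j : Fin I.numClients => (((j : ℕ) : ℝ) + 1) * I.d (I.cl y) f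

/-- The center sets that the algorithm tries. -/
noncomputable def centerSets (η : ℝ) (R : ℕ) : List I.CenterSet :=
  I.guesses.flatMap fun g => tuples (I.cands (I.greedy η (η ^ 2 / I.k * g) R)) I.k

/-- Pairs of a center set and a clustering that the algorithm compares. -/
noncomputable def pairs (η : ℝ) (R : ℕ) (A : I.CenterSet → I.Clustering) :
    List (I.CenterSet × I.Clustering) :=
  (I.centerSets η R).flatMap fun G => ((I.centerSets η R).map A).map fun τ => (G, τ)

/-- If `M` is the largest connection cost of a client, then `M ≤ Ψ ≤ numClients * M`, and rounding
`Ψ / M` down to an integer loses at most a factor two. As `M` is a distance between a client and a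
location, all such multiples can be listed. The guess zero covers `Ψ = 0`. -/
theorem exists_guess {Ψ : ℝ} (τ : I.Clustering) (fs : Fin I.k → Fin I.numFacilities)
    (hΨ : Ψ = I.serve fs τ) : ∃ g ∈ I.guesses, 0 ≤ g ∧ g ≤ Ψ ∧ Ψ ≤ 2 * g := by
  classical
  subst hΨ
  have hd := fun c : Fin I.numClients => I.d_nonneg (I.cl c) (fs (τ c))
  by_cases h0 : I.serve fs τ = 0
  · exact ⟨0, by simp [guesses], le_rfl, h0.ge, by rw [h0, mul_zero]⟩
  have hpos : 0 < I.serve fs τ := lt_of_le_of_ne (Finset.sum_nonneg fun c _ => hd c) (Ne.symm h0)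
  have hne : (Finset.univ : Finset (Fin I.numClients)).Nonempty := by
    by_contra h
    rw [Finset.not_nonempty_iff_eq_empty] at h
    rw [serve, h, Finset.sum_empty] at h0
    exact h0 rfl
  obtain ⟨y, _, hy⟩ := Finset.exists_max_image _ (fun c => I.d (I.cl c) (fs (τ c))) hne
  set M := I.d (I.cl y) (fs (τ y)) with hM
  have hle : I.serve fs τ ≤ I.numClients * M := by
    refine (Finset.sum_le_card_nsmul _ _ M fun c _ => hy c (Finset.mem_univ c)).trans ?_
    simp
  have hge : M ≤ I.serve fs τ :=
    Finset.single_le_sum (f := fun c => I.d (I.cl c) (fs (τ c))) (fun c _ => hd c)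
      (Finset.mem_univ y)
  have hM0 : 0 < M := by
    by_contra h
    have : (I.numClients : ℝ) * M ≤ 0 := mul_nonpos_of_nonneg_of_nonpos (by positivity) (not_lt.1 h)
    linarith
  set q := I.serve fs τ / M with hq
  have hqM : q * M = I.serve fs τ := div_mul_cancel₀ _ hM0.ne'
  have hq1 : 1 ≤ q := by rwa [hq, le_div_iff₀ hM0, one_mul]
  have hfl := Nat.floor_le (zero_le_one.trans hq1)
  have hfl2 := Nat.lt_floor_add_one q
  have hj1 : 1 ≤ ⌊q⌋₊ := by rwa [Nat.one_le_floor_iff]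
  have hjn : ⌊q⌋₊ ≤ I.numClients := by
    refine Nat.floor_le_of_le ?_
    rwa [hq, div_le_iff₀ hM0]
  have hj1' : (1 : ℝ) ≤ ⌊q⌋₊ := by exact_mod_cast hj1
  refine ⟨⌊q⌋₊ * M, ?_, by positivity, ?_, ?_⟩
  · rw [guesses]
    refine List.mem_cons_of_mem _ (List.mem_flatMap.2 ⟨y, List.mem_finRange _,
      List.mem_flatMap.2 ⟨fs (τ y), List.mem_finRange _, List.mem_map.2
        ⟨⟨⌊q⌋₊ - 1, by omega⟩, List.mem_finRange _, ?_⟩⟩⟩)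
    dsimp only
    rw [Nat.cast_sub hj1, Nat.cast_one, sub_add_cancel]
  · rw [← hqM]
    exact mul_le_mul_of_nonneg_right hfl hM0.le
  · rw [← hqM]
    nlinarith

theorem greedy_ne_nil (η θ : ℝ) (R : ℕ) : I.greedy η θ R ≠ [] := by
  cases R <;> simp [greedy]

theorem mem_centerSets {η g : ℝ} {R : ℕ} (hg : g ∈ I.guesses) {F : I.CenterSet}
    (hF : ∀ i, F i ∈ I.cands (I.greedy η (η ^ 2 / I.k * g) R)) : F ∈ I.centerSets η R :=
  List.mem_flatMap.2 ⟨g, hg, mem_tuples hF⟩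

theorem mem_pairs {η : ℝ} {R : ℕ} {A : I.CenterSet → I.Clustering}
    {a : I.CenterSet × I.Clustering} :
    a ∈ I.pairs η R A ↔ a.1 ∈ I.centerSets η R ∧ ∃ F ∈ I.centerSets η R, A F = a.2 := by
  simp only [pairs, List.mem_flatMap, List.mem_map]
  constructor
  · rintro ⟨G, hG, _, ⟨F, hF, rfl⟩, rfl⟩
    exact ⟨hG, F, hF, rfl⟩
  · rintro ⟨hG, F, hF, h⟩
    exact ⟨_, hG, _, ⟨F, hF, rfl⟩, by rw [h]⟩

theorem pairs_ne_nil (η : ℝ) (R : ℕ) (A : I.CenterSet → I.Clustering) : I.pairs η R A ≠ [] := by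
  obtain ⟨F, hF⟩ := exists_injective_choice
    (fun _ : Fin I.k => (I.cands (I.greedy η (η ^ 2 / I.k * 0) R)).toFinset) ∅ (fun _ => I.fac0)
    (by simp) (by simp) fun _ _ => k_le_card_cands (I.greedy_ne_nil _ _ _)
  have hF' : F ∈ I.centerSets η R :=
    I.mem_centerSets (by simp [guesses]) fun i => List.mem_toFinset.1 (hF i)
  exact List.ne_nil_of_mem (I.mem_pairs.2 ⟨hF', F, hF', rfl⟩ : (F, A F) ∈ _)

/-- The output of the algorithm: the pair of least cost. -/
noncomputable def best (η : ℝ) (R : ℕ) (A : I.CenterSet → I.Clustering) :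
    I.CenterSet × I.Clustering :=
  pick (fun a => 0 - I.serve a.1 a.2) ((I.pairs η R A).head (I.pairs_ne_nil η R A)) (I.pairs η R A)

theorem best_mem (η : ℝ) (R : ℕ) (A : I.CenterSet → I.Clustering) :
    I.best η R A ∈ I.pairs η R A := by
  have := pick_mem (fun a => 0 - I.serve a.1 a.2)
    ((I.pairs η R A).head (I.pairs_ne_nil η R A)) (I.pairs η R A)
  rcases List.mem_cons.1 this with h | h
  · rw [best, h]
    exact List.head_mem _
  · exact h

/-- Solutions are compared by `serve`, which is a plain sum, and not by `cost`, a minimum over `k!`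
permutations. The permutations are covered by trying all ordered tuples. The key is negated because
`pick` maximizes. -/
theorem serve_best_le {η : ℝ} {R : ℕ} {A : I.CenterSet → I.Clustering} {F G : I.CenterSet}
    (hF : F ∈ I.centerSets η R) (hG : G ∈ I.centerSets η R) :
    I.serve (I.best η R A).1 (I.best η R A).2 ≤ I.serve G (A F) := by
  have := le_pick (fun a => 0 - I.serve a.1 a.2)
    ((I.pairs η R A).head (I.pairs_ne_nil η R A)) (I.pairs η R A)
    (List.mem_cons_of_mem _ (I.mem_pairs.2 ⟨hG, F, hF, rfl⟩ : (G, A F) ∈ _))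
  rw [best]
  linarith

end Instance

section Programs

variable {ι : Type*} {m : ι → ℕ} {x : ι → Val}

theorem ComputesList.pairs {D : ι → Instance.{u}} {η : ι → ℝ} {R : ι → ℕ}
    {A : ∀ i, (D i).CenterSet → (D i).Clustering}
    (hS : ComputesList m x (fun i => (D i).encodeCenters) fun i => (D i).centerSets (η i) (R i))
    (hA : Computes (fun q : Σ i, (D i).CenterSet => m q.1)
      (fun q => .pair ((D q.1).encodeCenters q.2) (x q.1))
      fun q => (D q.1).encodeClustering (A q.1 q.2)) :
    ComputesList m x
      (fun i a => Val.pair ((D i).encodeCenters a.1) ((D i).encodeClustering a.2))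
      fun i => (D i).pairs (η i) (R i) (A i) :=
  hS.flatMap (((hS.map (eg := fun i => (D i).encodeClustering) hA).weaken _ _).map
    (Computes.id.snd.fst.pair Computes.id.fst))

end Programs

namespace ComputesData

variable {ι : Type*} {m : ι → ℕ} {x : ι → Val} {D : ι → Instance.{u}} (h : ComputesData m x D)
include h

theorem guesses : ComputesList m x (fun _ => Val.real) fun i => (D i).guesses := by
  refine ComputesList.cons ((Computes.natCast 0).congr fun _ => by simp) ?_
  have hC := ComputesList.finRange h.numClients h.numClients_bd
  have hC1 := hC.weaken (Sigma.fst : (Σ i, Fin (D i).numClients) → ι) fun q => .ofFin q.2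
  have hL := ComputesList.finRange h.numFacilities h.numFacilities_bd
  refine hC.flatMap ((hL.weaken _ _).flatMap (ComputesList.map
    (eb := fun q : Σ q : Σ i, Fin (D i).numClients, Fin (D q.1).numFacilities => Val.ofFin)
    (l := fun q => List.finRange (D q.1.1).numClients)
    (f := fun q j => (((j : ℕ) : ℝ) + 1) * (D q.1.1).d ((D q.1.1).cl q.1.2) q.2)
    (hC1.weaken _ _) ?_))
  refine Computes.mul (Computes.var.add Computes.one) ?_
  have h1 := h.weaken (Sigma.fst : (Σ i, Fin (D i).numClients) → ι) fun q => .ofFin q.2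
  exact Computes.weaken ((h1.weaken Sigma.fst fun q => .ofFin q.2).d
    (p := fun q : Σ q : Σ i, Fin (D i).numClients, Fin (D q.1).numFacilities => (D q.1.1).cl q.1.2)
    (f := fun q => q.2) Computes.id.snd.fst Computes.var) _ _

theorem serve {F : ∀ i, (D i).CenterSet} {τ : ∀ i, (D i).Clustering}
    (hF : Computes m x fun i => (D i).encodeCenters (F i))
    (hτ : Computes m x fun i => (D i).encodeClustering (τ i)) :
    Computes m x fun i => .real ((D i).serve (F i) (τ i)) := by
  refine Computes.sum_fin h.numClients h.numClients_bd ((h.weaken _ _).d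
    (p := fun q : Σ i, Fin (D i).numClients => (D q.1).cl q.2) Computes.var ?_)
  have h1 := Computes.nth (j := fun q : Σ i, Fin (D i).numClients => q.2)
    (h.numClients_bd.reindex _) (hτ.weaken _ _) Computes.var
  exact Computes.nth (f := fun (q : Σ i, Fin (D i).numClients) j => Val.ofFin (F q.1 j))
    (j := fun q => τ q.1 q.2) (h.k_bd.reindex _) (hF.weaken _ _) h1

variable {η u β : ι → ℝ} {R : ι → ℕ}

theorem centerSets (hη : Computes m x fun i => .real (η i)) (hu : Computes m x fun i => .real (u i))
    (hβ : Computes m x fun i => .real (β i)) (hR : PolyBd m R)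
    (hlt : ∀ i, ∀ j < R i, 1 ≤ u i * (1 - β i) ^ j) (hend : ∀ i, u i * (1 - β i) ^ R i < 1)
    (hb : PolyBd m fun i => ((R i + 1) * (D i).k + 1) ^ (D i).k) :
    ComputesList m x (fun i => (D i).encodeCenters) fun i => (D i).centerSets (η i) (R i) := by
  refine h.guesses.flatMap ?_
  have hlen : ∀ i g, ((D i).greedy (η i) (η i ^ 2 / (D i).k * g) (R i)).length = R i + 1 := by
    intro i g
    induction R i with
    | zero => rfl
    | succ j ih => rw [Instance.greedy, List.length_cons, ih]
  have h1 := h.weaken (Sigma.fst : (Σ _ : ι, ℝ) → ι) fun q => .real q.2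
  refine ComputesList.tuples h1.k h1.k_bd (h1.cands (h1.greedy (hη.weaken _ _)
    (Computes.mul ?_ Computes.var) (hu.weaken _ _) (hβ.weaken _ _) (hR.reindex _)
    (fun q => hlt q.1) (fun q => hend q.1))) ((hb.reindex _).mono fun q => ?_)
  · simp only [pow_two]
    exact ((hη.mul hη).div h.k).weaken _ _
  · rw [Instance.length_cands, hlen]

theorem best {A : ∀ i, (D i).CenterSet → (D i).Clustering}
    (hS : ComputesList m x (fun i => (D i).encodeCenters) fun i => (D i).centerSets (η i) (R i))
    (hA : Computes (fun q : Σ i, (D i).CenterSet => m q.1)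
      (fun q => .pair ((D q.1).encodeCenters q.2) (x q.1))
      fun q => (D q.1).encodeClustering (A q.1 q.2)) :
    Computes m x fun i => Val.pair ((D i).encodeCenters ((D i).best (η i) (R i) (A i)).1)
      ((D i).encodeClustering ((D i).best (η i) (R i) (A i)).2) := by
  have hp := ComputesList.pairs hS hA
  refine Computes.pick hp (Computes.head hp fun i => (D i).pairs_ne_nil (η i) (R i) (A i)) ?_
  refine Computes.sub ((Computes.natCast 0).congr fun _ => by simp) ?_
  exact (h.weaken _ _).serve Computes.var.fst Computes.var.snd

end ComputesData

/-! ## Approximation guarantee and running time -/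

namespace Instance

variable (I : Instance.{u})

theorem serve_eq (F : Fin I.k → Fin I.numFacilities) (σ : I.Clustering) :
    I.serve F σ = ∑ i : Fin I.k, ∑ x : Fin I.numClients with σ x = i,
      dist (I.client x) (I.facility (F i)) := by
  classical
  rw [serve, ← Finset.sum_fiberwise (s := Finset.univ) (g := σ)]
  refine Finset.sum_congr rfl fun i _ => Finset.sum_congr rfl fun c hc => ?_
  rw [(Finset.mem_filter.1 hc).2, d, pt_cl]

theorem cost_le_serve (F : I.CenterSet) (σ : I.Clustering) : I.cost F σ ≤ I.serve F σ := by
  rw [serve_eq]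
  exact ciInf_le (Set.finite_range _).bddBelow (1 : Equiv.Perm (Fin I.k))

theorem exists_serve_eq_cost (F : I.CenterSet) (σ : I.Clustering) :
    ∃ π : Equiv.Perm (Fin I.k), I.serve (π.toEmbedding.trans F) σ = I.cost F σ := by
  obtain ⟨π, hπ⟩ := exists_eq_ciInf_of_finite (f := fun π : Equiv.Perm (Fin I.k) =>
    ∑ i : Fin I.k, ∑ x : Fin I.numClients with σ x = i, dist (I.client x) (I.facility (F (π i))))
  exact ⟨π, by rw [serve_eq]; exact hπ⟩

theorem exists_serve_eq_optCost (σ : I.Clustering) :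
    ∃ F : I.CenterSet, I.serve F σ = I.optCost σ := by
  have : Nonempty I.CenterSet := ⟨Fin.castLEEmb I.k_le⟩
  obtain ⟨F, hF⟩ := exists_eq_ciInf_of_finite (f := fun F : I.CenterSet => I.cost F σ)
  obtain ⟨π, hπ⟩ := I.exists_serve_eq_cost F σ
  exact ⟨_, hπ.trans hF⟩

/-- The factor by which the greedy algorithm decreases the potential in each round. -/
noncomputable def decay (η : ℝ) : ℝ := η * η * η / (8 * (I.k * I.k * I.k))

/-- An upper bound on the initial potential. -/
noncomputable def initial : ℝ := 2 * I.k * I.numFacilities * I.numClients + 1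

theorem decay_pos {η : ℝ} (hη : 0 < η) : 0 < I.decay η := by
  have : (0 : ℝ) < I.k := by exact_mod_cast I.k_pos
  unfold decay
  positivity

theorem decay_le_one {η : ℝ} (hη : 0 < η) (hη1 : η ≤ 1) : I.decay η ≤ 1 := by
  have h1 : (1 : ℝ) ≤ I.k := by exact_mod_cast I.k_pos
  rw [decay, div_le_one (by positivity)]
  calc η * η * η ≤ 1 * 1 * 1 := by gcongr
    _ ≤ 8 * (1 * 1 * 1) := by norm_num
    _ ≤ _ := by gcongr

variable {I} in
theorem exists_good {η : ℝ} (hη : 0 < η) (hη1 : η ≤ 1) {R : ℕ}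
    (hR : I.initial * (1 - I.decay η) ^ R < 1) (τ : I.Clustering) :
    ∃ g ∈ I.guesses, (∃ F : I.CenterSet,
      (∀ i, F i ∈ I.cands (I.greedy η (η ^ 2 / I.k * g) R)) ∧
        I.serve F τ ≤ (3 + 22 * η) * I.optCost τ) ∧
    (I.ClientsSubsetFacilities → ∃ F : I.CenterSet,
      (∀ i, F i ∈ I.cands (I.greedy η (η ^ 2 / I.k * g) R)) ∧
        I.serve F τ ≤ (2 + 11 * η) * I.optCost τ) := by
  obtain ⟨fs, hfs⟩ := I.exists_serve_eq_optCost τ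
  obtain ⟨g, hgm, hg0, hgΨ, hΨg⟩ := I.exists_guess τ fs rfl
  have hk : (1 : ℝ) ≤ I.k := by exact_mod_cast I.k_pos
  have hθ : 0 ≤ η ^ 2 / I.k * g := by positivity
  obtain ⟨μ, hμ⟩ := exists_fractionalHitting hη hθ τ fs (by
    intro h0
    have hg : g = 0 := by
      rcases mul_eq_zero.1 h0 with h | h
      · have : 0 < η ^ 2 / (I.k : ℝ) := by positivity
        exact absurd h this.ne'
      · exact h
    subst hg
    refine le_antisymm ?_ hgΨ
    rwa [mul_zero] at hΨg)
  -- `Ψ ≤ 2g` gives `Ψ / (η * θ) ≤ 2k / η³`, so the mass is at most `W = 4k² / η³`; `I.decay η` is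
  -- exactly `1 / (2kW)`.
  have hW : I.decay η * (2 * I.k * (2 * I.k ^ 2 +
      (∑ c, I.d (I.cl c) (fs (τ c))) / (η * (η ^ 2 / I.k * g)))) ≤ 1 := by
    have h1 : (∑ c, I.d (I.cl c) (fs (τ c))) / (η * (η ^ 2 / I.k * g)) ≤ 2 * I.k / η ^ 3 := by
      rcases hg0.eq_or_lt with h | h
      · rw [← h, mul_zero, mul_zero, div_zero]
        positivity
      · rw [div_le_div_iff₀ (by positivity) (by positivity)]
        have h2 : 2 * (I.k : ℝ) * (η * (η ^ 2 / I.k * g)) = (2 * g) * η ^ 3 := by field_simp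
        rw [h2]
        exact mul_le_mul_of_nonneg_right hΨg (by positivity)
    have h2 : 2 * (I.k : ℝ) ^ 2 + 2 * I.k / η ^ 3 ≤ 4 * I.k ^ 2 / η ^ 3 := by
      have h3 : (2 * (I.k : ℝ) ^ 2) * η ^ 3 ≤ 2 * (I.k : ℝ) ^ 2 :=
        mul_le_of_le_one_right (by positivity) (pow_le_one₀ hη.le hη1)
      rw [← sub_nonneg]
      have h4 : 4 * (I.k : ℝ) ^ 2 / η ^ 3 - (2 * (I.k : ℝ) ^ 2 + 2 * I.k / η ^ 3) =
          (4 * (I.k : ℝ) ^ 2 - 2 * I.k - (2 * (I.k : ℝ) ^ 2) * η ^ 3) / η ^ 3 := by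
        field_simp
        ring
      rw [h4]
      refine div_nonneg ?_ (by positivity)
      nlinarith
    calc _ ≤ I.decay η * (2 * I.k * (4 * I.k ^ 2 / η ^ 3)) := by
          have := (I.decay_pos hη).le
          gcongr
          linarith
      _ = 1 := by
          unfold decay
          field_simp
          norm_num
  have hact : ∀ f y, ¬ I.Active η (η ^ 2 / I.k * g) (I.greedy η (η ^ 2 / I.k * g) R) f y :=
    fun f y => not_active_greedy hη.le hθ hμ (I.decay_pos hη).le (I.decay_le_one hη hη1) hW hR
  have := exists_good_centers hη hη1 hg0 (I.greedy_ne_nil _ _ _) hact τ fs hgΨ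
  rw [hfs] at this
  exact ⟨g, hgm, this⟩

-- Let `F` be good for `τ`. The partition `A F` is no worse than `τ` for `F`, and a reordering of
-- `F`, which is enumerated too, realizes `cost F (A F)` as `serve`. The centers depend on the
-- unknown `τ`, but the best pair competes with all of them at once.
variable {I} in
theorem isApproxSolution_best {η α : ℝ} {R : ℕ} {A : I.CenterSet → I.Clustering}
    (hA : ∀ F, A F ∈ I.feasible) (hopt : ∀ F, ∀ τ ∈ I.feasible, I.cost F (A F) ≤ I.cost F τ)
    (h : ∀ τ : I.Clustering, ∃ g ∈ I.guesses, ∃ F : I.CenterSet,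
      (∀ i, F i ∈ I.cands (I.greedy η (η ^ 2 / I.k * g) R)) ∧ I.serve F τ ≤ α * I.optCost τ) :
    I.IsApproxSolution α (I.best η R A).1 (I.best η R A).2 := by
  constructor
  · obtain ⟨F, -, hF⟩ := (I.mem_pairs.1 (I.best_mem η R A)).2
    rw [← hF]
    exact hA F
  · intro τ hτ
    obtain ⟨g, hg, F, hF, hle⟩ := h τ
    obtain ⟨π, hπ⟩ := I.exists_serve_eq_cost F (A F)
    calc I.cost (I.best η R A).1 (I.best η R A).2
        ≤ I.serve (I.best η R A).1 (I.best η R A).2 := I.cost_le_serve _ _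
      _ ≤ I.serve (π.toEmbedding.trans F) (A F) :=
          I.serve_best_le (I.mem_centerSets hg hF) (I.mem_centerSets hg fun i => hF _)
      _ = I.cost F (A F) := hπ
      _ ≤ I.cost F τ := hopt F τ hτ
      _ ≤ I.serve F τ := I.cost_le_serve _ _
      _ ≤ _ := hle

theorem two_le_size : 2 ≤ I.size := by
  have h1 := I.k_pos
  have h2 := I.k_le
  have h3 : 1 ≤ I.data.size := by cases I.data <;> simp [Val.size]
  unfold size
  omega

end Instance

/-! ### Numerical bounds on rounds, tuples and time. -/

/-- The least `R` is taken, and `(1 - β)^r ≤ exp(-r β)` is applied to `r = R - 1`. -/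
theorem exists_rounds {u β : ℝ} (hu : 1 ≤ u) (hβ : 0 < β) (hβ1 : β ≤ 1) :
    ∃ R : ℕ, (∀ j < R, 1 ≤ u * (1 - β) ^ j) ∧ u * (1 - β) ^ R < 1 ∧
      (R : ℝ) ≤ 1 + Real.log u / β := by
  classical
  have hu0 : 0 < u := by linarith
  have hex : ∃ R : ℕ, u * (1 - β) ^ R < 1 := by
    obtain ⟨R, hR⟩ := exists_pow_lt_of_lt_one (inv_pos.2 hu0) (by linarith : 1 - β < 1)
    refine ⟨R, ?_⟩
    rwa [mul_comm, ← lt_div_iff₀ hu0, one_div]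
  have hmin : ∀ j < Nat.find hex, 1 ≤ u * (1 - β) ^ j := fun j hj =>
    not_lt.1 (Nat.find_min hex hj)
  refine ⟨Nat.find hex, hmin, Nat.find_spec hex, ?_⟩
  have hlog : 0 ≤ Real.log u / β := div_nonneg (Real.log_nonneg hu) hβ.le
  rcases Nat.eq_zero_or_pos (Nat.find hex) with h0 | h0
  · rw [h0, Nat.cast_zero]
    linarith
  · obtain ⟨r, hr⟩ := Nat.exists_eq_succ_of_ne_zero h0.ne'
    have h1 := hmin r (by omega)
    have h2 : (1 - β) ^ r ≤ Real.exp (-(r * β)) := by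
      rw [show -(r * β) = r * (-β) by ring, Real.exp_nat_mul]
      exact pow_le_pow_left₀ (by linarith) (by linarith [Real.add_one_le_exp (-β)]) r
    have h3 : 1 ≤ u * Real.exp (-(r * β)) := h1.trans (mul_le_mul_of_nonneg_left h2 hu0.le)
    have h4 : Real.exp (r * β) ≤ u := by
      rwa [Real.exp_neg, ← div_eq_mul_inv, le_div_iff₀ (Real.exp_pos _), one_mul] at h3
    have h5 : r * β ≤ Real.log u := (Real.le_log_iff_exp_le hu0).2 h4
    rw [hr, Nat.cast_succ]
    have h6 : (r : ℝ) ≤ Real.log u / β := by rwa [le_div_iff₀ hβ]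
    linarith

theorem card_bound {k n R : ℕ} {ε u : ℝ} (hk : 1 ≤ k) (hn : 2 ≤ n) (hε : 0 < ε) (hε1 : ε ≤ 1)
    (hu : 1 ≤ u) (hun : u ≤ (n : ℝ) ^ 5)
    (hR : (R : ℝ) ≤ 1 + Real.log u * (2 ^ 18 * (k / ε) ^ 3)) :
    (((R + 1) * k + 1) ^ k : ℝ) ≤ 2 ^ 23 * (k / ε) ^ (26 * k) * n := by
  have hk1 : (1 : ℝ) ≤ k := by exact_mod_cast hk
  have hn2 : (2 : ℝ) ≤ n := by exact_mod_cast hn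
  set κ : ℝ := k / ε with hκ
  have hkκ : (k : ℝ) ≤ κ := by
    rw [hκ, le_div_iff₀ hε]
    exact mul_le_of_le_one_right (by linarith) hε1
  have hκ1 : 1 ≤ κ := hk1.trans hkκ
  set L := Real.log n with hL
  have hL0 : 0 ≤ L := Real.log_nonneg (by linarith)
  have hlogu : Real.log u ≤ 5 * L := by
    have := Real.log_le_log (by linarith) hun
    rwa [Real.log_pow] at this
  have hκ3 : 1 ≤ κ ^ 3 := one_le_pow₀ hκ1
  have h1 : ((R + 1) * k + 1 : ℝ) ≤ 2 ^ 21 * κ ^ 4 * (1 + L) := by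
    have h2 : (R : ℝ) ≤ 1 + 5 * L * (2 ^ 18 * κ ^ 3) := by
      refine hR.trans ?_
      gcongr
    have h3 : ((R + 1) * k + 1 : ℝ) ≤ (R + 2) * κ := by nlinarith [Nat.cast_nonneg (α := ℝ) R]
    have h4 : (R + 2 : ℝ) ≤ 2 ^ 21 * κ ^ 3 * (1 + L) := by
      have : 0 ≤ κ ^ 3 * L := by positivity
      nlinarith
    calc ((R + 1) * k + 1 : ℝ) ≤ (R + 2) * κ := h3
      _ ≤ 2 ^ 21 * κ ^ 3 * (1 + L) * κ := by gcongr
      _ = _ := by ring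
  -- One term of the exponential series: `(1 + L)^k ≤ k! * exp (1 + L)`, and `exp L = n`. This
  -- trades the power of the logarithm for `k^k` and one factor `n`.
  have h2 : (1 + L) ^ k ≤ 3 * κ ^ k * n := by
    have h3 := Real.pow_div_factorial_le_exp (1 + L) (by linarith) k
    rw [div_le_iff₀ (by exact_mod_cast k.factorial_pos), Real.exp_add, hL,
      Real.exp_log (by linarith)] at h3
    have h4 : (k.factorial : ℝ) ≤ κ ^ k := by
      refine le_trans (?_ : (k.factorial : ℝ) ≤ (k : ℝ) ^ k) (pow_le_pow_left₀ (by linarith) hkκ k)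
      exact_mod_cast Nat.factorial_le_pow k
    have h5 : Real.exp 1 ≤ 3 := by linarith [Real.exp_one_lt_d9]
    calc (1 + L) ^ k ≤ Real.exp 1 * n * k.factorial := h3
      _ ≤ 3 * n * κ ^ k := by gcongr
      _ = _ := by ring
  -- For `k ≥ 2` the base two is at most `κ`; for `k = 1` the constant stays in front.
  have h3 : ((2 : ℝ) ^ 21) ^ k ≤ 2 ^ 21 * κ ^ (21 * k) := by
    rcases hk.eq_or_lt with h | h
    · rw [← h, pow_one]
      exact le_mul_of_one_le_right (by positivity) (one_le_pow₀ hκ1)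
    · have h4 : (2 : ℝ) ≤ k := by exact_mod_cast h
      rw [← pow_mul]
      refine (pow_le_pow_left₀ (by norm_num) (h4.trans hkκ) _).trans ?_
      exact le_mul_of_one_le_left (by positivity) (by norm_num)
  calc (((R + 1) * k + 1) ^ k : ℝ) ≤ (2 ^ 21 * κ ^ 4 * (1 + L)) ^ k :=
        pow_le_pow_left₀ (by positivity) h1 k
    _ = (2 ^ 21) ^ k * κ ^ (4 * k) * (1 + L) ^ k := by rw [mul_pow, mul_pow, ← pow_mul κ]
    _ ≤ 2 ^ 21 * κ ^ (21 * k) * κ ^ (4 * k) * (3 * κ ^ k * n) := by gcongr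
    _ = 3 * 2 ^ 21 * κ ^ (26 * k) * n := by
        rw [show 26 * k = 21 * k + 4 * k + k by ring, pow_add, pow_add]
        ring
    _ ≤ _ := by gcongr; norm_num

theorem time_bound {k n X t d : ℕ} {ε : ℝ} (hk : 1 ≤ k) (hn : 2 ≤ n) (hε : 0 < ε) (hε1 : ε ≤ 1)
    (hX : (X : ℝ) ≤ 2 ^ 23 * (k / ε) ^ (26 * k) * n) (ht : t ≤ (n + X + 2) ^ d) :
    (t : ℝ) ≤ (2 ^ (24 * d) + 26 * d : ℕ) * ((k : ℝ) / ε) ^ ((2 ^ (24 * d) + 26 * d) * k) *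
      (n : ℝ) ^ (2 ^ (24 * d) + 26 * d) := by
  have hk1 : (1 : ℝ) ≤ k := by exact_mod_cast hk
  have hn2 : (2 : ℝ) ≤ n := by exact_mod_cast hn
  have hκ1 : 1 ≤ (k : ℝ) / ε := by
    rw [le_div_iff₀ hε]
    linarith
  set κ : ℝ := k / ε
  have hκ : 1 ≤ κ ^ (26 * k) := one_le_pow₀ hκ1
  have h1 : (n + X + 2 : ℝ) ≤ 2 ^ 24 * κ ^ (26 * k) * n := by
    have : (n : ℝ) ≤ κ ^ (26 * k) * n := le_mul_of_one_le_left (by linarith) hκ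
    linarith
  have h2 : (t : ℝ) ≤ (2 ^ 24 * κ ^ (26 * k) * n) ^ d := by
    refine le_trans (?_ : (t : ℝ) ≤ (n + X + 2 : ℝ) ^ d) (pow_le_pow_left₀ (by positivity) h1 d)
    exact_mod_cast ht
  have hpos : 1 ≤ 2 ^ (24 * d) := Nat.one_le_two_pow
  -- One number has to dominate the factor `2 ^ (24 * d)` and both exponents, `26 * d` and `d`.
  set c := 2 ^ (24 * d) + 26 * d with hc
  calc (t : ℝ) ≤ (2 ^ 24 * κ ^ (26 * k) * n) ^ d := h2
    _ = 2 ^ (24 * d) * κ ^ (26 * d * k) * n ^ d := by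
        rw [mul_pow, mul_pow, ← pow_mul, ← pow_mul]
        ring_nf
    _ ≤ c * κ ^ (c * k) * (n : ℝ) ^ c := by
        have h3 : (2 : ℝ) ^ (24 * d) ≤ c := by
          rw [hc]
          push_cast
          have : (0 : ℝ) ≤ 26 * d := by positivity
          linarith
        have h4 : 26 * d * k ≤ c * k := Nat.mul_le_mul_right k (by omega)
        have h5 : d ≤ c := by omega
        have h6 : (1 : ℝ) ≤ n := by linarith
        gcongr

theorem initial_le_size_pow (I : Instance.{u}) : I.initial ≤ (I.size : ℝ) ^ 5 := by
  have hn : (2 : ℝ) ≤ I.size := by exact_mod_cast I.two_le_size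
  have hL : I.numFacilities ≤ I.size := by unfold Instance.size; omega
  have hC : I.numClients ≤ I.size := by unfold Instance.size; omega
  have hk : I.k ≤ I.size := I.k_le.trans hL
  have hL' : (I.numFacilities : ℝ) ≤ I.size := by exact_mod_cast hL
  have hC' : (I.numClients : ℝ) ≤ I.size := by exact_mod_cast hC
  have hk' : (I.k : ℝ) ≤ I.size := by exact_mod_cast hk
  set n : ℝ := (I.size : ℝ)
  calc I.initial ≤ 2 * n * n * n + 1 := by unfold Instance.initial; gcongr
    _ ≤ n ^ 4 + 1 := by nlinarith [pow_pos (by linarith : 0 < n) 3]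
    _ ≤ n ^ 5 := by nlinarith [pow_le_pow_left₀ (by norm_num) hn 4]

/-- Everything that the algorithm needs can be computed from the input. -/
theorem computesData_input {ι : Type*} {m : ι → ℕ} {D : ι → Instance.{u}} {ε : ι → ℝ}
    (hm : ∀ i, (D i).size ≤ m i) :
    ComputesData m (fun i => .pair (.real (ε i)) (D i).encode) D := by
  have hid := Computes.id (m := m) (x := fun i => .pair (.real (ε i)) (D i).encode)
  have hin : Computes m (fun i => .pair (.real (ε i)) (D i).encode) fun i =>
      .pair (.real (D i).k) (.pair
        (.ofMatrix fun a b => dist ((D i).client a) ((D i).client b)) (.pair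
        (.ofMatrix fun a b => dist ((D i).client a) ((D i).facility b)) (.pair
        (.ofMatrix fun a b => dist ((D i).facility a) ((D i).facility b)) (.pair (D i).data .nil)))) :=
    hid.snd
  have hC : PolyBd m fun i => (D i).numClients :=
    PolyBd.self.mono fun i => le_trans (by unfold Instance.size; omega) (hm i)
  have hL : PolyBd m fun i => (D i).numFacilities :=
    PolyBd.self.mono fun i => le_trans (by unfold Instance.size; omega) (hm i)
  have hCL : ComputesList m (fun i => .pair (.real (ε i)) (D i).encode) (fun _ => id)
      fun i => List.ofFn fun a => Val.ofSeq fun b =>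
        .real (dist ((D i).client a) ((D i).facility b)) :=
    ⟨hin.snd.snd.fst.congr fun i => by simp [Val.ofListMap, Val.ofMatrix, Val.ofSeq],
      hC.mono fun i => by simp⟩
  have hLL : ComputesList m (fun i => .pair (.real (ε i)) (D i).encode) (fun _ => id)
      fun i => List.ofFn fun a => Val.ofSeq fun b =>
        .real (dist ((D i).facility a) ((D i).facility b)) :=
    ⟨hin.snd.snd.snd.fst.congr fun i => by simp [Val.ofListMap, Val.ofMatrix, Val.ofSeq],
      hL.mono fun i => by simp⟩
  -- The numbers of clients and locations are read off as numbers of matrix rows, and the rows for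
  -- `d` are those of the clients followed by those of the facilities.
  refine ⟨(Computes.length hCL).congr fun i => by simp,
    (Computes.length hLL).congr fun i => by simp, hin.fst,
    (hCL.append hLL).1.congr fun i => ?_, hC, hL⟩
  dsimp only
  rw [← List.ofFn_fin_append, Val.ofMatrix, Val.ofSeq, Val.ofListMap, List.map_id]
  congr 2
  funext p
  refine Fin.addCases (fun c => ?_) (fun f => ?_) p
  · rw [Fin.append_left]
    congr 1
    funext b
    rw [Instance.d, Instance.pt_cl]
  · rw [Fin.append_right]
    congr 1
    funext b
    rw [Instance.d, Instance.pt_fc]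

/-- The complete algorithm as a program. -/
theorem exists_program {ι : Type*} (D : ι → Instance.{u}) (ε : ι → ℝ) (R : ι → ℕ)
    (A : ∀ i, (D i).CenterSet → (D i).Clustering) (code : Code) (c : ℕ)
    (hcode : ∀ i F, ∃ t, Eval code (.pair ((D i).encodeCenters F) (D i).encode) []
      ((D i).encodeClustering (A i F)) t ∧ t ≤ c * (D i).size ^ c)
    (hlt : ∀ i, ∀ j < R i, 1 ≤ (D i).initial * (1 - (D i).decay (ε i / 32)) ^ j)
    (hend : ∀ i, (D i).initial * (1 - (D i).decay (ε i / 32)) ^ R i < 1) :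
    ∃ (B : Code) (d : ℕ), ∀ i, ∃ t ≤ ((D i).size + ((R i + 1) * (D i).k + 1) ^ (D i).k + 2) ^ d,
      Eval B (.pair (.real (ε i)) (D i).encode) []
        (.pair ((D i).encodeCenters ((D i).best (ε i / 32) (R i) (A i)).1)
          ((D i).encodeClustering ((D i).best (ε i / 32) (R i) (A i)).2)) t := by
  -- The bound on the number of tuples is part of the measure, which makes the exhaustive
  -- enumeration polynomial.
  set m : ι → ℕ := fun i => (D i).size + ((R i + 1) * (D i).k + 1) ^ (D i).k with hm
  have hD : ComputesData m (fun i => .pair (.real (ε i)) (D i).encode) D :=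
    computesData_input fun i => Nat.le_add_right _ _
  have hid := Computes.id (m := m) (x := fun i => .pair (.real (ε i)) (D i).encode)
  have hη : Computes m (fun i => .pair (.real (ε i)) (D i).encode) fun i => .real (ε i / 32) :=
    hid.fst.div (Computes.natCast 32)
  have hβ : Computes m (fun i => .pair (.real (ε i)) (D i).encode) fun i =>
      .real ((D i).decay (ε i / 32)) :=
    ((hη.mul hη).mul hη).div ((Computes.natCast 8).mul ((hD.k.mul hD.k).mul hD.k))
  have hu : Computes m (fun i => .pair (.real (ε i)) (D i).encode) fun i =>
      .real (D i).initial :=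
    ((((Computes.natCast 2).mul hD.k).mul hD.numFacilities).mul hD.numClients).add Computes.one
  have hb : PolyBd m fun i => ((R i + 1) * (D i).k + 1) ^ (D i).k :=
    PolyBd.self.mono fun i => Nat.le_add_left _ _
  have hR : PolyBd m R := hb.mono fun i => by
    have h1 : 1 ≤ (D i).k := (D i).k_pos
    calc R i ≤ (R i + 1) * (D i).k + 1 := by nlinarith
      _ ≤ _ := Nat.le_self_pow (by omega) _
  have hS := hD.centerSets hη hu hβ hR hlt hend hb
  choose t ht htc using hcode
  have hA : Computes (fun q : Σ i, (D i).CenterSet => m q.1)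
      (fun q => .pair ((D q.1).encodeCenters q.2) (.pair (.real (ε q.1)) (D q.1).encode))
      fun q => (D q.1).encodeClustering (A q.1 q.2) := by
    refine (Computes.id.fst.pair Computes.id.snd.snd).comp ⟨code, fun q => t q.1 q.2, ?_,
      fun q => ht q.1 q.2⟩
    refine (((PolyBd.const c).mul (PolyBd.self.pow c)).reindex Sigma.fst).mono fun q => ?_
    exact (htc q.1 q.2).trans (Nat.mul_le_mul_left _
      (Nat.pow_le_pow_left (Nat.le_add_right _ _) _))
  obtain ⟨B, T, ⟨d, hd⟩, hB⟩ := hD.best hS hA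
  exact ⟨B, d, fun i => ⟨T i, hd i, hB i⟩⟩

theorem one_half_le_successProb {B : Code} {I : Instance.{u}} {ε α : ℝ} {F : I.CenterSet}
    {σ : I.Clustering} {t : ℕ} (h : ∀ ω, Outputs B I ε ω F σ t) (hα : I.IsApproxSolution α F σ) :
    1 / 2 ≤ successProb B I ε α := by
  have huniv : {ω | ∃ F σ t, Outputs B I ε ω F σ t ∧ I.IsApproxSolution α F σ} = Set.univ :=
    Set.eq_univ_of_forall fun ω => ⟨F, σ, t, h ω, hα⟩
  have : MeasureTheory.IsProbabilityMeasure coinMeasure := by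
    unfold coinMeasure
    infer_instance
  rw [successProb, huniv, MeasureTheory.measure_univ]
  exact ENNReal.half_le_self

end KMedian

theorem mainTheorem4 (P : Set KMedian.Instance.{u})
    (hP : KMedian.HasEfficientPartitionAlgorithm P) :
    ∃ (B : KMedian.Code) (c : ℕ), ∀ I ∈ P, ∀ ε : ℝ, 0 < ε → ε ≤ 1 →
      (∀ ω : ℕ → Bool, ∃ F σ t, KMedian.Outputs B I ε ω F σ t ∧ σ ∈ I.feasible ∧
        (t : ℝ) ≤ c * ((I.k : ℝ) / ε) ^ (c * I.k) * (I.size : ℝ) ^ c) ∧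
      1 / 2 ≤ KMedian.successProb B I ε (3 + ε) ∧
      (I.ClientsSubsetFacilities → 1 / 2 ≤ KMedian.successProb B I ε (2 + ε)) := by
  obtain ⟨code, c, hcode⟩ := hP
  choose A hfeas hopt hrun using hcode
  -- All instances of the problem and all `ε` form one family, so that a single program serves them
  -- all.
  let ι := {q : KMedian.Instance.{u} × ℝ // q.1 ∈ P ∧ 0 < q.2 ∧ q.2 ≤ 1}
  have hinit : ∀ I : KMedian.Instance.{u}, 1 ≤ I.initial := fun I => by
    unfold KMedian.Instance.initial
    exact le_add_of_nonneg_left (by positivity)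
  have hη : ∀ q : ι, 0 < q.1.2 / 32 ∧ q.1.2 / 32 ≤ 1 := fun q =>
    ⟨by linarith [q.2.2.1], by linarith [q.2.2.2]⟩
  choose R hlt hend hR using fun q : ι => KMedian.exists_rounds (hinit q.1.1)
    (q.1.1.decay_pos (hη q).1) (q.1.1.decay_le_one (hη q).1 (hη q).2)
  obtain ⟨B, d, hB⟩ := KMedian.exists_program (fun q : ι => q.1.1) (fun q => q.1.2) R
    (fun q F => A q.1.1 q.2.1 F) code c (fun q F => hrun q.1.1 q.2.1 F) hlt hend
  refine ⟨B, 2 ^ (24 * d) + 26 * d, fun I hI ε hε hε1 => ?_⟩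
  obtain ⟨t, ht, hEval⟩ := hB ⟨(I, ε), hI, hε, hε1⟩
  have hR' := hR ⟨(I, ε), hI, hε, hε1⟩
  have hst := hend ⟨(I, ε), hI, hε, hε1⟩
  have hη' := hη ⟨(I, ε), hI, hε, hε1⟩
  generalize R ⟨(I, ε), hI, hε, hε1⟩ = r at *
  dsimp only at *
  -- No coin is flipped, so the run is the same for every `ω`.
  have hout : ∀ ω, KMedian.Outputs B I ε ω (I.best (ε / 32) r (A I hI)).1
      (I.best (ε / 32) r (A I hI)).2 t := fun ω => ⟨0, by simpa using hEval⟩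
  have happrox : ∀ α, (∀ τ : I.Clustering, ∃ g ∈ I.guesses, ∃ F : I.CenterSet,
      (∀ i, F i ∈ I.cands (I.greedy (ε / 32) ((ε / 32) ^ 2 / I.k * g) r)) ∧
        I.serve F τ ≤ α * I.optCost τ) →
      I.IsApproxSolution α (I.best (ε / 32) r (A I hI)).1 (I.best (ε / 32) r (A I hI)).2 :=
    fun α h => KMedian.Instance.isApproxSolution_best (hfeas I hI) (hopt I hI) h
  have hopt0 : ∀ τ : I.Clustering, 0 ≤ I.optCost τ := fun τ => by
    obtain ⟨F, hF⟩ := I.exists_serve_eq_optCost τ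
    rw [← hF]
    exact Finset.sum_nonneg fun c _ => I.d_nonneg _ _
  -- With `η = ε / 32` the errors `22 * η` and `11 * η` are below `ε`.
  have h3 := happrox (3 + ε) fun τ => by
    obtain ⟨g, hg, ⟨F, hF, hle⟩, -⟩ := KMedian.Instance.exists_good hη'.1 hη'.2 hst τ
    exact ⟨g, hg, F, hF, hle.trans (mul_le_mul_of_nonneg_right (by linarith) (hopt0 τ))⟩
  refine ⟨fun ω => ⟨_, _, t, hout ω, h3.1, ?_⟩, KMedian.one_half_le_successProb hout h3,
    fun hsub => KMedian.one_half_le_successProb hout (happrox (2 + ε) fun τ => ?_)⟩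
  · refine KMedian.time_bound I.k_pos I.two_le_size hε hε1 ?_ ht
    push_cast
    -- The constant `2 ^ 18` is `8 * 32 ^ 3`, from the reciprocal of `decay (ε / 32)`.
    refine KMedian.card_bound I.k_pos I.two_le_size hε hε1 (hinit I)
      (KMedian.initial_le_size_pow I) (hR'.trans (le_of_eq ?_))
    have hk : (I.k : ℝ) ≠ 0 := by exact_mod_cast I.k_pos.ne'
    unfold KMedian.Instance.decay
    field_simp
    ring
  · obtain ⟨g, hg, -, h⟩ := KMedian.Instance.exists_good hη'.1 hη'.2 hst τ
    obtain ⟨F, hF, hle⟩ := h hsub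
    exact ⟨g, hg, F, hF, hle.trans (mul_le_mul_of_nonneg_right (by linarith) (hopt0 τ))⟩
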